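/- Let $n,m\ge 0$ be integers, and let $\mu$ be the standard Gaussian measure on $\mathbb{R}^n$, $d\mu(x)=(2\pi)^{-n/2}e^{-|x|^2/2}dx$. Let $E_1,\dots,E_m$ be linear subspaces of $\mathbb{R}^n$ and $c_1,\dots,c_m>0$ real numbers such that $$\mathrm{Id}_{\mathbb{R}^n}=\sum_{i=1}^m c_i\,Q_{E_i},$$ where $Q_{E_i}$ denotes the orthogonal projection onto $E_i$. Then for every smooth ($C^\infty$) function $f:\mathbb{R}^n\to\mathbb{R}$ such that $|f|\le 1$, $$\mathrm{Var}_\mu(f)\le C\sum_{i=1}^m c_i\,\frac{\|Q_{E_i}(\nabla f)\|_1\,\bigl(1+\|Q_{E_i}(\nabla f)\|_1\bigr)}{\bigl[1+\log^+\bigl(1/\|Q_{E_i}(\nabla f)\|_1\bigr)\bigr]^{1/2}},$$ where $C>0$ is a numerical constant (independent of $n$, $m$, the $E_i$, the $c_i$ and $f$). Here $\mathrm{Var}_\mu(f)=\int f^2\,d\mu-\bigl(\int f\,d\mu\bigr)^2$, $\log^+ u=\max(\log u,0)$, and $\|Q_{E_i}(\nabla f)\|_1=\int_{\mathbb{R}^n}|Q_{E_i}(\nabla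 f)|\,d\mu\in[0,\infty]$ with $|\cdot|$ the Euclidean norm; the $i$-th quotient is read as $0$ if $\|Q_{E_i}(\nabla f)\|_1=0$ and as $+\infty$ if $\|Q_{E_i}(\nabla f)\|_1=\infty$. -/

import Mathlib

open MeasureTheory ProbabilityTheory
open scoped ENNReal NNReal ContDiff

noncomputable section

/-- A geometric Brascamp–Lieb decomposition of the identity of `ℝⁿ`: subspaces `E i` and weights
`c i > 0` with `Id = ∑ i, c i • Q_{E i}`, where `Q_{E i}` is the orthogonal projection onto
`E i`. -/
def IsGeometricBrascampLieb {n m : ℕ} (E : Fin m → Submodule ℝ (EuclideanSpace ℝ (Fin n)))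
    (c : Fin m → ℝ) : Prop :=
  (∀ i, 0 < c i) ∧
    ContinuousLinearMap.id ℝ (EuclideanSpace ℝ (Fin n)) = ∑ i, c i • (E i).starProjection

/-- The `L¹(μ)` norm `‖Q_E (∇ f)‖₁` of the projected gradient, for the standard Gaussian measure
`μ` on `ℝⁿ`, as an extended nonnegative number (it is `∞` if the projected gradient is not
integrable). -/
def projGradL1 {n : ℕ} (E : Submodule ℝ (EuclideanSpace ℝ (Fin n)))
    (f : EuclideanSpace ℝ (Fin n) → ℝ) : ℝ≥0∞ :=
  eLpNorm (fun x => E.starProjection (gradient f x)) 1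
    (stdGaussian (EuclideanSpace ℝ (Fin n)))

/-- The function `b ↦ b (1 + b) / [1 + log⁺ (1 / b)] ^ (1 / 2)` on `[0, ∞]`, with its limit
values `0` at `0` and `∞` at `∞`. -/
def influenceFun (b : ℝ≥0∞) : ℝ≥0∞ :=
  b * (1 + b) / ENNReal.ofReal (Real.sqrt (1 + Real.posLog (1 / b).toReal))

end

/-!
The proof interpolates along the Ornstein–Uhlenbeck semigroup. Let `X` and `X_θ` be standard
Gaussian vectors with `X_θ = cos θ X + sin θ Y`, `Y` an independent copy of `X`. Differentiating
`θ ↦ E[f(X) f(X_θ)]` gives (`variance_eq_integral_correlation`)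

  `Var f = ∫_0^{π/2} sin θ · E⟨∇f(X), ∇f(X_θ)⟩ dθ`,

and the decomposition of the identity splits the correlation into
`∑ i, c i * E⟨Q_i ∇f(X), Q_i ∇f(X_θ)⟩`, so each subspace can be treated separately.

For one projected gradient `g = Q ∇f` with `‖g‖₁ ≤ a`, write `cos θ = s⁴`. Part of the noise is
averaged out on both sides, which replaces `g` by `G = P_s g` and the correlation `s⁴` by `s²`
(`integral_inner_gaussianCoupling_sq_mul`). Since `|f| ≤ 1`, Gaussian integration by parts bounds
`G` by `B = (1 - s²)^{-1/2}` (`norm_ornsteinUhlenbeck_gradient_le`). Gaussian hypercontractivity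
with exponent `p = 1 + s²` and interpolation between `L¹` and `L∞` then bound the correlation by
`(B^{p-1} a)^{2/p}`. The exponent `2/p` exceeds `1` by at least a multiple of `θ²`, and
`sin θ · B ≤ 2`, so for `a ≤ 1` the integrand is at most a constant times `a exp(-κ θ² log (1/a))`,
whose integral has the order `a / √(log (1/a))`.

Hypercontractivity is proved in the form `E[f(X) g(X')] ≤ ‖f‖_p ‖g‖_p` for vectors of correlation
`ρ = p - 1`. It follows from Bonami's two-point inequality for correlated signs: the inequality
is stable under convolution of couplings (`IsHypercontractive.conv`), and the Gaussian coupling is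
a weak limit of such convolutions by Lévy's continuity theorem
(`exists_tendsto_gaussianCoupling`).

The argument needs a bounded gradient; the general case follows by multiplying `f` with smooth
cutoffs.
-/

/-! ### The two-point inequality -/

lemma two_mul_le_one_add_rpow_sub {q x : ℝ} (hq0 : 0 ≤ q) (hq1 : q ≤ 1) (hx0 : 0 ≤ x)
    (hx1 : x ≤ 1) : 2 * q * x ≤ (1 + x) ^ q - (1 - x) ^ q := by
  rcases hq0.eq_or_lt with rfl | hq
  · simp
  have hmono : MonotoneOn (fun x : ℝ => (1 + x) ^ q - (1 - x) ^ q - 2 * q * x)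
      (Set.Icc 0 1) := by
    have hd : ∀ x ∈ Set.Ioo (0 : ℝ) 1,
        HasDerivAt (fun x : ℝ => (1 + x) ^ q - (1 - x) ^ q - 2 * q * x)
          (q * (1 + x) ^ (q - 1) + q * (1 - x) ^ (q - 1) - 2 * q) x := by
      intro x hx
      have h1 : HasDerivAt (fun x : ℝ => (1 + x) ^ q) (1 * q * (1 + x) ^ (q - 1)) x :=
        ((hasDerivAt_id x).const_add 1).rpow_const (Or.inl (by simp; linarith [hx.1]))
      have h2 : HasDerivAt (fun x : ℝ => (1 - x) ^ q) (-1 * q * (1 - x) ^ (q - 1)) x :=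
        ((hasDerivAt_id x).const_sub 1).rpow_const (Or.inl (by simp; linarith [hx.2]))
      have h3 : HasDerivAt (fun x : ℝ => 2 * q * x) (2 * q) x := by
        simpa using (hasDerivAt_id x).const_mul (2 * q)
      exact ((h1.sub h2).sub h3).congr_deriv (by ring)
    refine monotoneOn_of_deriv_nonneg (convex_Icc 0 1) ?_ ?_ ?_
    · refine ContinuousOn.sub (ContinuousOn.sub ?_ ?_) (by fun_prop)
      · exact ContinuousOn.rpow_const (by fun_prop) fun _ _ => Or.inr hq.le
      · exact ContinuousOn.rpow_const (by fun_prop) fun _ _ => Or.inr hq.le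
    · rw [interior_Icc]
      exact fun x hx => (hd x hx).differentiableAt.differentiableWithinAt
    · rw [interior_Icc]
      intro x hx
      rw [(hd x hx).deriv]
      have hA : 0 < 1 + x := by linarith [hx.1]
      have hB : 0 < 1 - x := by linarith [hx.2]
      have hprod : 1 ≤ (1 + x) ^ (q - 1) * (1 - x) ^ (q - 1) := by
        rw [← Real.mul_rpow hA.le hB.le]
        exact Real.one_le_rpow_of_pos_of_le_one_of_nonpos (by positivity)
          (by nlinarith [sq_nonneg x]) (by linarith)
      have hpA := Real.rpow_pos_of_pos hA (q - 1)
      have hpB := Real.rpow_pos_of_pos hB (q - 1)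
      have : 2 ≤ (1 + x) ^ (q - 1) + (1 - x) ^ (q - 1) := by
        nlinarith [sq_nonneg ((1 + x) ^ (q - 1) - (1 - x) ^ (q - 1))]
      nlinarith
  have := hmono (Set.left_mem_Icc.2 zero_le_one) ⟨hx0, hx1⟩ hx0
  simp at this
  linarith

lemma one_add_sq_le_add_rpow {ρ x : ℝ} (h0 : 0 ≤ ρ) (h1 : ρ ≤ 1) (hx0 : 0 ≤ x)
    (hx1 : x ≤ 1) :
    1 + (1 + ρ) / 2 * ρ * x ^ 2 ≤ ((1 + x) ^ (1 + ρ) + (1 - x) ^ (1 + ρ)) / 2 := by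
  have hmono : MonotoneOn (fun x : ℝ => (1 + x) ^ (1 + ρ) + (1 - x) ^ (1 + ρ)
      - (1 + ρ) * ρ * x ^ 2) (Set.Icc 0 1) := by
    have hd : ∀ x ∈ Set.Ioo (0 : ℝ) 1,
        HasDerivAt (fun x : ℝ => (1 + x) ^ (1 + ρ) + (1 - x) ^ (1 + ρ)
          - (1 + ρ) * ρ * x ^ 2)
          ((1 + ρ) * ((1 + x) ^ ρ - (1 - x) ^ ρ - 2 * ρ * x)) x := by
      intro x hx
      have h1 := ((hasDerivAt_id x).const_add 1).rpow_const (p := 1 + ρ)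
        (Or.inl (by simp; linarith [hx.1]))
      have h2 := ((hasDerivAt_id x).const_sub 1).rpow_const (p := 1 + ρ)
        (Or.inl (by simp; linarith [hx.2]))
      have h3 := ((hasDerivAt_id x).pow 2).const_mul ((1 + ρ) * ρ)
      refine ((h1.add h2).sub h3).congr_deriv ?_
      simp only [id, add_sub_cancel_left]
      norm_num
      ring
    refine monotoneOn_of_deriv_nonneg (convex_Icc 0 1) ?_ ?_ ?_
    · refine ContinuousOn.sub (ContinuousOn.add ?_ ?_) (by fun_prop)
      · exact ContinuousOn.rpow_const (by fun_prop) fun _ _ => Or.inr (by linarith)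
      · exact ContinuousOn.rpow_const (by fun_prop) fun _ _ => Or.inr (by linarith)
    · rw [interior_Icc]
      exact fun x hx => (hd x hx).differentiableAt.differentiableWithinAt
    · rw [interior_Icc]
      intro x hx
      rw [(hd x hx).deriv]
      have := two_mul_le_one_add_rpow_sub h0 h1 hx.1.le hx.2.le
      exact mul_nonneg (by linarith) (by linarith)
  have := hmono (Set.left_mem_Icc.2 zero_le_one) ⟨hx0, hx1⟩ hx0
  simp at this
  linarith

/-- Bonami's two-point inequality for a nonnegative function on `{-1, 1}` with values `A`, `B`:
the left side is the `L²` norm after noise of parameter `√ρ` has been applied. -/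
lemma bonami_two_point {ρ A B : ℝ} (h0 : 0 ≤ ρ) (h1 : ρ ≤ 1) (hA : 0 ≤ A) (hB : 0 ≤ B) :
    √(((A + B) / 2) ^ 2 + ρ * ((A - B) / 2) ^ 2) ≤
      ((A ^ (1 + ρ) + B ^ (1 + ρ)) / 2) ^ (1 / (1 + ρ)) := by
  wlog hAB : B ≤ A generalizing A B
  · have := this hB hA (le_of_not_ge hAB)
    rw [add_comm (A ^ _), add_comm A]
    convert this using 3
    ring
  rcases hA.eq_or_lt with rfl | hA
  · obtain rfl : B = 0 := le_antisymm hAB hB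
    simp
    positivity
  set a := (A + B) / 2 with ha
  have hapos : 0 < a := by positivity
  set x := (A - B) / 2 / a with hx
  have hx0 : 0 ≤ x := div_nonneg (by linarith) hapos.le
  have hx1 : x ≤ 1 := by rw [hx, div_le_one hapos]; linarith
  have eA : A = a * (1 + x) := by rw [hx]; field_simp; ring
  have eB : B = a * (1 - x) := by rw [hx]; field_simp; ring
  have eD : (A - B) / 2 = a * x := by rw [hx]; field_simp
  have hp : (0 : ℝ) < 1 + ρ := by linarith
  rw [eD, one_div (1 + ρ), Real.le_rpow_inv_iff_of_pos (by positivity) (by positivity) hp,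
    Real.sqrt_eq_rpow, ← Real.rpow_mul (by positivity)]
  rw [show a ^ 2 + ρ * (a * x) ^ 2 = a ^ (2 : ℝ) * (1 + ρ * x ^ 2) by
      rw [Real.rpow_two]; ring,
    Real.mul_rpow (by positivity) (by positivity), ← Real.rpow_mul hapos.le]
  rw [eA, eB, Real.mul_rpow hapos.le (by linarith), Real.mul_rpow hapos.le (by linarith),
    show (2 : ℝ) * (1 / 2 * (1 + ρ)) = 1 + ρ by ring]
  have hbern := rpow_one_add_le_one_add_mul_self (s := ρ * x ^ 2) (p := 1 / 2 * (1 + ρ))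
    (by nlinarith [mul_nonneg h0 (sq_nonneg x)]) (by linarith) (by linarith)
  have := one_add_sq_le_add_rpow h0 h1 hx0 hx1
  have hap := Real.rpow_pos_of_pos hapos (1 + ρ)
  nlinarith

/-- The two-function form of Bonami's inequality, for signs of correlation `ρ`: the two functions
take the values `A`, `B` and `C`, `D`. -/
lemma two_point_two_function {ρ A B C D : ℝ} (h0 : 0 ≤ ρ) (h1 : ρ ≤ 1) (hA : 0 ≤ A)
    (hB : 0 ≤ B) (hC : 0 ≤ C) (hD : 0 ≤ D) :
    (1 + ρ) / 4 * (A * C + B * D) + (1 - ρ) / 4 * (A * D + B * C) ≤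
      ((A ^ (1 + ρ) + B ^ (1 + ρ)) / 2) ^ (1 / (1 + ρ)) *
        ((C ^ (1 + ρ) + D ^ (1 + ρ)) / 2) ^ (1 / (1 + ρ)) := by
  refine le_trans ?_ (mul_le_mul (bonami_two_point h0 h1 hA hB) (bonami_two_point h0 h1 hC hD)
    (by positivity) (by positivity))
  rw [← Real.sqrt_mul (by positivity)]
  -- The left side is `ac + ρbd` with `a, c` the means and `b, d` the half-differences.
  apply Real.le_sqrt_of_sq_le
  nlinarith [mul_nonneg h0 (sq_nonneg ((A + B) * (C - D) - (A - B) * (C + D)))]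

lemma two_point_two_function_ennreal {ρ : ℝ} (h0 : 0 ≤ ρ) (h1 : ρ ≤ 1) (A B C D : ℝ≥0∞) :
    ENNReal.ofReal ((1 + ρ) / 4) * (A * C + B * D) +
        ENNReal.ofReal ((1 - ρ) / 4) * (A * D + B * C) ≤
      (ENNReal.ofReal (1 / 2) * (A ^ (1 + ρ) + B ^ (1 + ρ))) ^ (1 / (1 + ρ)) *
        (ENNReal.ofReal (1 / 2) * (C ^ (1 + ρ) + D ^ (1 + ρ))) ^ (1 / (1 + ρ)) := by
  have hp : (0 : ℝ) < 1 + ρ := by linarith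
  have hp' : (0 : ℝ) < 1 / (1 + ρ) := by positivity
  have hz : ∀ A B : ℝ≥0∞,
      (ENNReal.ofReal (1 / 2) * (A ^ (1 + ρ) + B ^ (1 + ρ))) ^ (1 / (1 + ρ)) = 0 →
        A = 0 ∧ B = 0 := by
    intro A B h
    have h2 : ¬ (1 / 2 : ℝ) ≤ 0 := by norm_num
    simpa [ENNReal.rpow_eq_zero_iff, hp, hp', hp.not_gt, hp'.not_gt, -one_div, h2] using h
  have ht : ∀ A B : ℝ≥0∞, A = ⊤ ∨ B = ⊤ →
      (ENNReal.ofReal (1 / 2) * (A ^ (1 + ρ) + B ^ (1 + ρ))) ^ (1 / (1 + ρ)) = ⊤ := by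
    rintro A B (rfl | rfl) <;> simp [hp, hp', ENNReal.mul_top, -one_div]
  by_cases hAB : A = ⊤ ∨ B = ⊤
  · rw [ht A B hAB]
    by_cases hCD : (ENNReal.ofReal (1 / 2) * (C ^ (1 + ρ) + D ^ (1 + ρ))) ^ (1 / (1 + ρ)) = 0
    · obtain ⟨rfl, rfl⟩ := hz C D hCD
      simp
    · rw [ENNReal.top_mul hCD]
      exact le_top
  by_cases hCD : C = ⊤ ∨ D = ⊤
  · rw [ht C D hCD]
    by_cases hAB : (ENNReal.ofReal (1 / 2) * (A ^ (1 + ρ) + B ^ (1 + ρ))) ^ (1 / (1 + ρ)) = 0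
    · obtain ⟨rfl, rfl⟩ := hz A B hAB
      simp
    · rw [ENNReal.mul_top hAB]
      exact le_top
  push Not at hAB hCD
  lift A to ℝ≥0 using hAB.1
  lift B to ℝ≥0 using hAB.2
  lift C to ℝ≥0 using hCD.1
  lift D to ℝ≥0 using hCD.2
  have key := two_point_two_function h0 h1 A.2 B.2 C.2 D.2
  have := ENNReal.ofReal_le_ofReal key
  have e : ∀ x : ℝ≥0, (x : ℝ≥0∞) = ENNReal.ofReal x := fun x => by simp
  have e2 : ∀ x y : ℝ≥0, (ENNReal.ofReal (1 / 2) * ((x : ℝ≥0∞) ^ (1 + ρ)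
      + (y : ℝ≥0∞) ^ (1 + ρ))) ^ (1 / (1 + ρ)) =
      ENNReal.ofReal (((x : ℝ) ^ (1 + ρ) + (y : ℝ) ^ (1 + ρ)) / 2) ^ (1 / (1 + ρ)) := by
    intro x y
    rw [e x, e y, ENNReal.ofReal_rpow_of_nonneg x.coe_nonneg hp.le,
      ENNReal.ofReal_rpow_of_nonneg y.coe_nonneg hp.le,
      ← ENNReal.ofReal_add (by positivity) (by positivity),
      ← ENNReal.ofReal_mul (by norm_num)]
    congr 2
    ring
  rw [e2, e2, ENNReal.ofReal_rpow_of_nonneg (by positivity) hp'.le,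
    ENNReal.ofReal_rpow_of_nonneg (by positivity) hp'.le, ← ENNReal.ofReal_mul (by positivity)]
  refine le_trans (le_of_eq ?_) this
  rw [e A, e B, e C, e D]
  have h1' : 0 ≤ 1 - ρ := by linarith
  rw [← ENNReal.ofReal_mul A.coe_nonneg, ← ENNReal.ofReal_mul B.coe_nonneg, ← ENNReal.ofReal_mul A.coe_nonneg,
    ← ENNReal.ofReal_mul B.coe_nonneg, ← ENNReal.ofReal_add (by positivity) (by positivity),
    ← ENNReal.ofReal_add (by positivity) (by positivity), ← ENNReal.ofReal_mul (by positivity),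
    ← ENNReal.ofReal_mul (by positivity), ← ENNReal.ofReal_add (by positivity) (by positivity)]
  rfl

/-! ### Hypercontractive couplings and their convolutions -/

section Hypercontractive

open Filter Topology WithLp
open scoped RealInnerProductSpace

section SignCoupling

variable {E : Type*} [NormedAddCommGroup E] [MeasurableSpace E]

/-- The law of `(ε e, ε' e)`, where `ε` and `ε'` are random signs of correlation `ρ`. -/
noncomputable def signCoupling (ρ : ℝ) (e : E) : Measure (WithLp 2 (E × E)) :=
  (ENNReal.ofReal ((1 + ρ) / 4) • (Measure.dirac (toLp 2 (e, e)) +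
      Measure.dirac (toLp 2 (-e, -e)))) +
    ENNReal.ofReal ((1 - ρ) / 4) • (Measure.dirac (toLp 2 (e, -e)) +
      Measure.dirac (toLp 2 (-e, e)))

lemma lintegral_signCoupling (ρ : ℝ) (e : E) {f : WithLp 2 (E × E) → ℝ≥0∞} (hf : Measurable f) :
    ∫⁻ v, f v ∂(signCoupling ρ e) =
      ENNReal.ofReal ((1 + ρ) / 4) * (f (toLp 2 (e, e)) + f (toLp 2 (-e, -e))) +
        ENNReal.ofReal ((1 - ρ) / 4) * (f (toLp 2 (e, -e)) + f (toLp 2 (-e, e))) := by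
  simp only [signCoupling, lintegral_add_measure, lintegral_smul_measure, smul_eq_mul,
    lintegral_dirac' _ hf]

lemma ofReal_one_add_add_one_sub {ρ : ℝ} (h0 : 0 ≤ ρ) (h1 : ρ ≤ 1) :
    ENNReal.ofReal ((1 + ρ) / 4) + ENNReal.ofReal ((1 - ρ) / 4) = ENNReal.ofReal (1 / 2) := by
  rw [← ENNReal.ofReal_add (by linarith) (by linarith)]
  congr 1
  ring

lemma isProbabilityMeasure_signCoupling {ρ : ℝ} (h0 : 0 ≤ ρ) (h1 : ρ ≤ 1) (e : E) :
    IsProbabilityMeasure (signCoupling ρ e) := by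
  constructor
  rw [← lintegral_one, lintegral_signCoupling _ _ measurable_const, ← add_mul,
    ofReal_one_add_add_one_sub h0 h1]
  rw [one_add_one_eq_two, show (2 : ℝ≥0∞) = ENNReal.ofReal 2 by simp,
    ← ENNReal.ofReal_mul (by norm_num)]
  norm_num

end SignCoupling

variable {E : Type*} [NormedAddCommGroup E] [InnerProductSpace ℝ E] [FiniteDimensional ℝ E]
  [MeasurableSpace E] [BorelSpace E]

/-- A measure `π` on `E × E` (with the Euclidean product structure) satisfies the two-function
hypercontractive inequality with exponent `p` if `∫ f(x) g(y) dπ ≤ ‖f(x)‖_p ‖g(y)‖_p` for all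
nonnegative measurable `f` and `g`, both norms being taken with respect to `π`. -/
def IsHypercontractive (p : ℝ) (π : Measure (WithLp 2 (E × E))) : Prop :=
  ∀ f g : E → ℝ≥0∞, Measurable f → Measurable g →
    ∫⁻ v, f v.fst * g v.snd ∂π ≤
      (∫⁻ v, f v.fst ^ p ∂π) ^ (1 / p) * (∫⁻ v, g v.snd ^ p ∂π) ^ (1 / p)

lemma IsHypercontractive.conv {p : ℝ} (hp : 0 < p) {π₁ π₂ : Measure (WithLp 2 (E × E))}
    [SFinite π₁] [SFinite π₂]
    (h₁ : IsHypercontractive p π₁) (h₂ : IsHypercontractive p π₂) :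
    IsHypercontractive p (π₁ ∗ π₂) := by
  intro f g hf hg
  have hF : Measurable fun x => (∫⁻ w, f (x + w.fst) ^ p ∂π₂) ^ (1 / p) :=
    (Measurable.lintegral_prod_right' (f := fun z : E × WithLp 2 (E × E) => f (z.1 + z.2.fst) ^ p)
      (by fun_prop)).pow_const _
  have hG : Measurable fun x => (∫⁻ w, g (x + w.snd) ^ p ∂π₂) ^ (1 / p) :=
    (Measurable.lintegral_prod_right' (f := fun z : E × WithLp 2 (E × E) => g (z.1 + z.2.snd) ^ p)
      (by fun_prop)).pow_const _
  rw [Measure.lintegral_conv (by fun_prop), Measure.lintegral_conv (by fun_prop),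
    Measure.lintegral_conv (by fun_prop)]
  calc ∫⁻ v, ∫⁻ w, f (v + w).fst * g (v + w).snd ∂π₂ ∂π₁
      ≤ ∫⁻ v, (∫⁻ w, f (v.fst + w.fst) ^ p ∂π₂) ^ (1 / p) *
          (∫⁻ w, g (v.snd + w.snd) ^ p ∂π₂) ^ (1 / p) ∂π₁ := by
        refine lintegral_mono fun v => ?_
        exact h₂ (fun x => f (v.fst + x)) (fun x => g (v.snd + x)) (by fun_prop) (by fun_prop)
    _ ≤ _ := by
        refine (h₁ _ _ hF hG).trans (le_of_eq ?_)
        simp only [← ENNReal.rpow_mul, one_div, inv_mul_cancel₀ hp.ne', ENNReal.rpow_one]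
        rfl

lemma isHypercontractive_dirac_zero {p : ℝ} (hp : 0 < p) :
    IsHypercontractive p (Measure.dirac (0 : WithLp 2 (E × E))) := by
  intro f g hf hg
  rw [lintegral_dirac' _ (by fun_prop), lintegral_dirac' _ (by fun_prop),
    lintegral_dirac' _ (by fun_prop)]
  simp only [← ENNReal.rpow_mul, one_div, mul_inv_cancel₀ hp.ne', ENNReal.rpow_one]
  exact le_rfl

/-- Characteristic functions of hypercontractive probability measures are closed under finite
products. -/
lemma exists_isHypercontractive_charFun_prod {ι : Type*} (s : Finset ι) {p : ℝ} (hp : 0 < p)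
    (π : ι → Measure (WithLp 2 (E × E))) [∀ i, IsProbabilityMeasure (π i)]
    (h : ∀ i, IsHypercontractive p (π i)) :
    ∃ π' : Measure (WithLp 2 (E × E)), IsProbabilityMeasure π' ∧ IsHypercontractive p π' ∧
      ∀ t, charFun π' t = ∏ i ∈ s, charFun (π i) t := by
  classical
  induction s using Finset.induction_on with
  | empty =>
    exact ⟨Measure.dirac 0, inferInstance, isHypercontractive_dirac_zero hp, fun t => by simp⟩
  | insert i s hi ih =>
    obtain ⟨π', hprob, hyp, hchar⟩ := ih
    exact ⟨π i ∗ π', inferInstance, (h i).conv hp hyp, fun t => by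
      rw [charFun_conv, hchar, Finset.prod_insert hi]⟩

lemma isHypercontractive_signCoupling {ρ : ℝ} (h0 : 0 ≤ ρ) (h1 : ρ ≤ 1) (e : E) :
    IsHypercontractive (1 + ρ) (signCoupling ρ e) := by
  intro f g hf hg
  rw [lintegral_signCoupling _ _ (by fun_prop), lintegral_signCoupling _ _ (by fun_prop),
    lintegral_signCoupling _ _ (by fun_prop)]
  refine (two_point_two_function_ennreal h0 h1 (f e) (f (-e)) (g e) (g (-e))).trans
    (le_of_eq ?_)
  rw [← ofReal_one_add_add_one_sub h0 h1, add_mul, add_mul]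
  congr 3
  simp only [toLp_snd]
  rw [add_comm (g (-e) ^ _)]

lemma charFun_signCoupling {ρ : ℝ} (h0 : 0 ≤ ρ) (h1 : ρ ≤ 1) (e : E) (t : WithLp 2 (E × E)) :
    charFun (signCoupling ρ e) t =
      (((1 + ρ) / 2 * Real.cos (⟪e, t.fst⟫ + ⟪e, t.snd⟫) +
        (1 - ρ) / 2 * Real.cos (⟪e, t.fst⟫ - ⟪e, t.snd⟫) : ℝ) : ℂ) := by
  have hi : ∀ x : WithLp 2 (E × E), Integrable (fun v => Complex.exp (⟪v, t⟫ * Complex.I))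
      (Measure.dirac x) := fun x => integrable_dirac (by simp)
  rw [charFun_apply, signCoupling, integral_add_measure, integral_smul_measure,
    integral_smul_measure, integral_add_measure (hi _) (hi _), integral_add_measure (hi _) (hi _)]
  rotate_left
  · exact ((hi _).add_measure (hi _)).smul_measure (by simp)
  · exact ((hi _).add_measure (hi _)).smul_measure (by simp)
  simp only [integral_dirac, prod_inner_apply, inner_neg_left]
  rw [ENNReal.toReal_ofReal (by linarith), ENNReal.toReal_ofReal (by linarith)]
  simp only [Complex.real_smul]
  push_cast
  rw [Complex.cos, Complex.cos]
  simp only [WithLp.fst, WithLp.snd]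
  ring_nf

/-! ### Gaussian couplings -/

lemma tendsto_mul_cos_div_sqrt_sub_one (x : ℝ) :
    Tendsto (fun n : ℕ => (n : ℝ) * (Real.cos (x / √n) - 1)) atTop (𝓝 (-(x ^ 2 / 2))) := by
  have h0 : Tendsto (fun n : ℕ => x / √(n : ℝ)) atTop (𝓝 0) :=
    tendsto_const_nhds.div_atTop (Real.tendsto_sqrt_atTop.comp tendsto_natCast_atTop_atTop)
  have hb : ∀ᶠ n : ℕ in atTop, |x / √(n : ℝ)| ≤ 1 := by
    have := h0.abs
    rw [abs_zero] at this
    exact this.eventually_le_const one_pos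
  rw [tendsto_iff_norm_sub_tendsto_zero]
  have hlim : Tendsto (fun n : ℕ => x ^ 4 * (5 / 96) / (n : ℝ)) atTop (𝓝 0) :=
    tendsto_const_nhds.div_atTop tendsto_natCast_atTop_atTop
  refine squeeze_zero' (Eventually.of_forall fun _ => norm_nonneg _) ?_ hlim
  filter_upwards [hb, eventually_gt_atTop 0] with n hn hpos
  have hn' : (0 : ℝ) < n := by exact_mod_cast hpos
  have hsq : (x / √(n : ℝ)) ^ 2 = x ^ 2 / n := by
    rw [div_pow, Real.sq_sqrt hn'.le]
  have := Real.cos_bound hn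
  have e1 : (n : ℝ) * (Real.cos (x / √n) - 1) - -(x ^ 2 / 2) =
      n * (Real.cos (x / √n) - (1 - (x / √n) ^ 2 / 2)) := by
    rw [hsq]
    field_simp
    ring
  rw [e1, Real.norm_eq_abs, abs_mul, abs_of_pos hn']
  calc (n : ℝ) * |Real.cos (x / √n) - (1 - (x / √n) ^ 2 / 2)|
      ≤ n * (|x / √n| ^ 4 * (5 / 96)) := by gcongr
    _ = x ^ 4 * (5 / 96) / n := by
      rw [show |x / √(n : ℝ)| ^ 4 = ((x / √(n : ℝ)) ^ 2) ^ 2 by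
        rw [← abs_pow, ← pow_mul, abs_of_nonneg (by positivity)], hsq]
      field_simp

/-- One coordinate of the characteristic function of a normalized convolution of `n` sign
couplings, in the limit `n → ∞`. -/
lemma tendsto_cos_mix_pow (ρ x y : ℝ) :
    Tendsto (fun n : ℕ => ((1 + ρ) / 2 * Real.cos (x / √n + y / √n) +
        (1 - ρ) / 2 * Real.cos (x / √n - y / √n)) ^ n) atTop
      (𝓝 (Real.exp (-(x ^ 2 + y ^ 2 + 2 * ρ * (x * y)) / 2))) := by
  have h := ((tendsto_mul_cos_div_sqrt_sub_one (x + y)).const_mul ((1 + ρ) / 2)).add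
    ((tendsto_mul_cos_div_sqrt_sub_one (x - y)).const_mul ((1 - ρ) / 2))
  have := Real.tendsto_one_add_pow_exp_of_tendsto
    (g := fun n : ℕ => (1 + ρ) / 2 * (Real.cos ((x + y) / √n) - 1) +
      (1 - ρ) / 2 * (Real.cos ((x - y) / √n) - 1)) (h.congr fun n => by ring)
  refine (this.congr fun n => ?_).mono_right (le_of_eq ?_)
  · rw [← add_div, ← sub_div]
    ring
  · ring_nf

variable (E) in
/-- The law of `(X, ρ X + √(1 - ρ²) Y)`, a pair of standard Gaussian vectors of correlation `ρ`;
here `X` and `Y` are independent standard Gaussian vectors. -/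
noncomputable def gaussianCoupling (ρ : ℝ) : Measure (WithLp 2 (E × E)) :=
  ((stdGaussian E).prod (stdGaussian E)).map
    fun z => toLp 2 (z.1, ρ • z.1 + √(1 - ρ ^ 2) • z.2)

instance (ρ : ℝ) : IsProbabilityMeasure (gaussianCoupling E ρ) :=
  Measure.isProbabilityMeasure_map (Measurable.aemeasurable (by fun_prop))

lemma charFun_gaussianCoupling {ρ : ℝ} (hρ : ρ ^ 2 ≤ 1) (t : WithLp 2 (E × E)) :
    charFun (gaussianCoupling E ρ) t =
      (Real.exp (-(‖t.fst‖ ^ 2 + ‖t.snd‖ ^ 2 + 2 * ρ * ⟪t.fst, t.snd⟫) / 2) : ℝ) := by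
  have hs : √(1 - ρ ^ 2) ^ 2 = 1 - ρ ^ 2 := Real.sq_sqrt (by linarith)
  rw [charFun_apply, gaussianCoupling, integral_map (Measurable.aemeasurable (by fun_prop))
    (Measurable.aestronglyMeasurable (by fun_prop))]
  have e : ∀ z : E × E, Complex.exp (⟪toLp 2 (z.1, ρ • z.1 + √(1 - ρ ^ 2) • z.2), t⟫ * Complex.I) =
      Complex.exp (⟪z.1, t.fst + ρ • t.snd⟫ * Complex.I) *
        Complex.exp (⟪z.2, √(1 - ρ ^ 2) • t.snd⟫ * Complex.I) := by
    intro z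
    rw [← Complex.exp_add, ← add_mul, ← Complex.ofReal_add]
    congr 3
    simp only [prod_inner_apply, inner_add_left, inner_add_right, real_inner_smul_left,
      real_inner_smul_right, WithLp.fst, WithLp.snd]
    ring
  simp_rw [e]
  rw [integral_prod_mul (fun x : E => Complex.exp (⟪x, t.fst + ρ • t.snd⟫ * Complex.I))
    (fun y : E => Complex.exp (⟪y, √(1 - ρ ^ 2) • t.snd⟫ * Complex.I)),
    ← charFun_apply, ← charFun_apply, charFun_stdGaussian, charFun_stdGaussian,
    ← Complex.exp_add]
  push_cast
  congr 1
  rw [← Complex.ofReal_pow, ← Complex.ofReal_pow, norm_add_sq_real, norm_smul, norm_smul, mul_pow,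
    mul_pow, Real.norm_eq_abs, Real.norm_eq_abs, sq_abs, sq_abs, hs, real_inner_smul_right]
  push_cast
  ring

lemma tendsto_lintegral_of_continuous_bounded {Ω : Type*} [MeasurableSpace Ω]
    [TopologicalSpace Ω] [OpensMeasurableSpace Ω] {μs : ℕ → ProbabilityMeasure Ω}
    {μ : ProbabilityMeasure Ω} (hμ : Tendsto μs atTop (𝓝 μ)) {h : Ω → ℝ≥0} (hc : Continuous h)
    {K : ℝ≥0} (hK : ∀ x, h x ≤ K) :
    Tendsto (fun n => ∫⁻ x, h x ∂(μs n : Measure Ω)) atTop (𝓝 (∫⁻ x, h x ∂(μ : Measure Ω))) := by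
  refine ProbabilityMeasure.tendsto_iff_forall_lintegral_tendsto.1 hμ ⟨⟨h, hc⟩, K, fun x y => ?_⟩
  simp only [NNReal.dist_eq]
  have h1 : (h x : ℝ) ≤ K := hK x
  have h2 : (h y : ℝ) ≤ K := hK y
  rw [abs_le]
  constructor <;> linarith [(h x).coe_nonneg, (h y).coe_nonneg]

/-- The Gaussian coupling is the weak limit of normalized convolutions of sign couplings along an
orthonormal basis. -/
lemma exists_tendsto_gaussianCoupling {ρ : ℝ} (h0 : 0 ≤ ρ) (h1 : ρ ≤ 1) :
    ∃ π : ℕ → ProbabilityMeasure (WithLp 2 (E × E)),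
      (∀ n, IsHypercontractive (1 + ρ) (π n : Measure (WithLp 2 (E × E)))) ∧
      Tendsto π atTop (𝓝 ⟨gaussianCoupling E ρ, inferInstance⟩) := by
  let b := stdOrthonormalBasis ℝ E
  have key : ∀ n : ℕ, ∃ π' : Measure (WithLp 2 (E × E)), IsProbabilityMeasure π' ∧
      IsHypercontractive (1 + ρ) π' ∧ ∀ t, charFun π' t =
        ∏ i ∈ (Finset.univ : Finset (Fin (Module.finrank ℝ E) × Fin n)),
          charFun (signCoupling ρ ((√(n : ℝ))⁻¹ • b i.1)) t := by
    intro n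
    have := fun i : Fin (Module.finrank ℝ E) × Fin n =>
      isProbabilityMeasure_signCoupling h0 h1 ((√(n : ℝ))⁻¹ • b i.1)
    exact exists_isHypercontractive_charFun_prod Finset.univ (by linarith)
      (fun i : Fin (Module.finrank ℝ E) × Fin n => signCoupling ρ ((√(n : ℝ))⁻¹ • b i.1))
      fun i => isHypercontractive_signCoupling h0 h1 _
  choose π hprob hyp hchar using key
  refine ⟨fun n => ⟨π n, hprob n⟩, hyp, ProbabilityMeasure.tendsto_iff_tendsto_charFun.2
    fun t => ?_⟩
  have hlim : Tendsto (fun n : ℕ => ∏ i, ((1 + ρ) / 2 *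
        Real.cos (⟪b i, t.fst⟫ / √n + ⟪b i, t.snd⟫ / √n) +
        (1 - ρ) / 2 * Real.cos (⟪b i, t.fst⟫ / √n - ⟪b i, t.snd⟫ / √n)) ^ n) atTop
      (𝓝 (∏ i, Real.exp (-(⟪b i, t.fst⟫ ^ 2 + ⟪b i, t.snd⟫ ^ 2 +
        2 * ρ * (⟪b i, t.fst⟫ * ⟪b i, t.snd⟫)) / 2))) :=
    tendsto_finsetProd _ fun i _ => tendsto_cos_mix_pow ρ _ _
  have hlim2 := (Complex.continuous_ofReal.tendsto _).comp hlim
  simp only [ProbabilityMeasure.coe_mk]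
  rw [charFun_gaussianCoupling (by nlinarith) t]
  convert hlim2 using 1
  · ext n
    rw [hchar, Fintype.prod_prod_type]
    simp only [charFun_signCoupling h0 h1, Finset.prod_const, Finset.card_univ, Fintype.card_fin,
      real_inner_smul_left, Function.comp_apply]
    push_cast
    simp only [div_eq_inv_mul]
  · rw [← Real.exp_sum, ← Finset.sum_div, Finset.sum_neg_distrib, Finset.sum_add_distrib,
      Finset.sum_add_distrib, ← Finset.mul_sum, b.sum_sq_inner_right, b.sum_sq_inner_right]
    have := b.sum_inner_mul_inner t.fst t.snd
    simp only [real_inner_comm _ t.fst] at this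
    rw [this, real_inner_comm t.fst t.snd]

/-- Gaussian hypercontractivity in its two-function form. -/
theorem lintegral_gaussianCoupling_mul_le {ρ : ℝ} (h0 : 0 ≤ ρ) (h1 : ρ ≤ 1)
    {f g : E → ℝ≥0} (hf : Continuous f) (hg : Continuous g) {K : ℝ≥0} (hfK : ∀ x, f x ≤ K)
    (hgK : ∀ x, g x ≤ K) :
    ∫⁻ v, f v.fst * g v.snd ∂(gaussianCoupling E ρ) ≤
      (∫⁻ v, (f v.fst : ℝ≥0∞) ^ (1 + ρ) ∂(gaussianCoupling E ρ)) ^ (1 / (1 + ρ)) *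
        (∫⁻ v, (g v.snd : ℝ≥0∞) ^ (1 + ρ) ∂(gaussianCoupling E ρ)) ^ (1 / (1 + ρ)) := by
  obtain ⟨π, hπ, hlim⟩ := exists_tendsto_gaussianCoupling (E := E) h0 h1
  have hp : (0 : ℝ) < 1 + ρ := by linarith
  have l1 := tendsto_lintegral_of_continuous_bounded hlim
    (h := fun v => f v.fst * g v.snd) (K := K * K) (by fun_prop)
    fun v => mul_le_mul' (hfK _) (hgK _)
  have l2 := tendsto_lintegral_of_continuous_bounded hlim
    (h := fun v => f v.fst ^ (1 + ρ)) (K := K ^ (1 + ρ))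
    ((NNReal.continuous_rpow_const hp.le).comp (by fun_prop))
    fun v => NNReal.rpow_le_rpow (hfK _) hp.le
  have l3 := tendsto_lintegral_of_continuous_bounded hlim
    (h := fun v => g v.snd ^ (1 + ρ)) (K := K ^ (1 + ρ))
    ((NNReal.continuous_rpow_const hp.le).comp (by fun_prop))
    fun v => NNReal.rpow_le_rpow (hgK _) hp.le
  have hfin : ∀ h : E → ℝ≥0, (∀ x, h x ≤ K) → ∀ F : WithLp 2 (E × E) → E,
      (∫⁻ v, (h (F v) : ℝ≥0∞) ^ (1 + ρ) ∂(gaussianCoupling E ρ)) ^ (1 / (1 + ρ)) ≠ ⊤ := by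
    intro h hh F
    refine ENNReal.rpow_ne_top_of_nonneg (by positivity) (ne_of_lt ?_)
    calc ∫⁻ v, (h (F v) : ℝ≥0∞) ^ (1 + ρ) ∂(gaussianCoupling E ρ)
        ≤ ∫⁻ v, (K : ℝ≥0∞) ^ (1 + ρ) ∂(gaussianCoupling E ρ) :=
          lintegral_mono fun v => ENNReal.rpow_le_rpow (by exact_mod_cast hh _) hp.le
      _ < ⊤ := by simp [ENNReal.rpow_lt_top_of_nonneg hp.le]
  simp only [ENNReal.coe_mul, ← ENNReal.coe_rpow_of_nonneg _ hp.le, ProbabilityMeasure.coe_mk]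
    at l1 l2 l3 hfin ⊢
  refine le_of_tendsto_of_tendsto' l1 (ENNReal.Tendsto.mul (l2.ennrpow_const _)
    (Or.inr (hfin g hgK _)) (l3.ennrpow_const _) (Or.inr (hfin f hfK _))) fun n => ?_
  have := hπ n (fun x => f x) (fun x => g x) (by fun_prop) (by fun_prop)
  simpa only [← ENNReal.coe_rpow_of_nonneg _ hp.le] using this

end Hypercontractive

/-! ### The Ornstein–Uhlenbeck semigroup -/

section OrnsteinUhlenbeck

open Filter Topology WithLp
open scoped RealInnerProductSpace

variable {E : Type*} [NormedAddCommGroup E] [InnerProductSpace ℝ E] [FiniteDimensional ℝ E]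
  [MeasurableSpace E] [BorelSpace E]

lemma map_smul_add_smul_stdGaussian {a b : ℝ} (h : a ^ 2 + b ^ 2 = 1) :
    ((stdGaussian E).prod (stdGaussian E)).map (fun z => a • z.1 + b • z.2) = stdGaussian E := by
  have : IsProbabilityMeasure (((stdGaussian E).prod (stdGaussian E)).map
      (fun z => a • z.1 + b • z.2)) :=
    Measure.isProbabilityMeasure_map (Measurable.aemeasurable (by fun_prop))
  refine Measure.ext_of_charFun (funext fun t => ?_)
  rw [charFun_apply, integral_map (Measurable.aemeasurable (by fun_prop))
    (Measurable.aestronglyMeasurable (by fun_prop))]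
  have e : ∀ z : E × E, Complex.exp (⟪a • z.1 + b • z.2, t⟫ * Complex.I) =
      Complex.exp (⟪z.1, a • t⟫ * Complex.I) * Complex.exp (⟪z.2, b • t⟫ * Complex.I) := by
    intro z
    rw [← Complex.exp_add, ← add_mul, ← Complex.ofReal_add]
    congr 3
    simp only [inner_add_left, real_inner_smul_left, real_inner_smul_right]
  simp_rw [e]
  rw [integral_prod_mul (fun x : E => Complex.exp (⟪x, a • t⟫ * Complex.I))
    (fun y : E => Complex.exp (⟪y, b • t⟫ * Complex.I)),
    ← charFun_apply, ← charFun_apply, charFun_stdGaussian, charFun_stdGaussian,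
    charFun_stdGaussian, ← Complex.exp_add]
  congr 1
  rw [norm_smul, norm_smul, Real.norm_eq_abs, Real.norm_eq_abs, ← Complex.ofReal_pow,
    ← Complex.ofReal_pow, mul_pow, mul_pow, sq_abs, sq_abs]
  have h' : (a : ℂ) ^ 2 + (b : ℂ) ^ 2 = 1 := by exact_mod_cast h
  push_cast
  linear_combination (-(‖t‖ : ℂ) ^ 2 / 2) * h'

lemma map_fst_gaussianCoupling (ρ : ℝ) :
    (gaussianCoupling E ρ).map (fun v => v.fst) = stdGaussian E := by
  rw [gaussianCoupling, Measure.map_map (by fun_prop) (by fun_prop)]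
  exact Measure.map_fst_prod.trans (by simp)

lemma map_snd_gaussianCoupling {ρ : ℝ} (hρ : ρ ^ 2 ≤ 1) :
    (gaussianCoupling E ρ).map (fun v => v.snd) = stdGaussian E := by
  rw [gaussianCoupling, Measure.map_map (by fun_prop) (by fun_prop)]
  exact map_smul_add_smul_stdGaussian (by rw [Real.sq_sqrt (by linarith)]; ring)

/-- Scaling a coupled pair by `s` and adding independent noise to both members multiplies the
correlation by `s²`. -/
lemma gaussianCoupling_sq_mul {s r : ℝ} (hs : s ^ 2 ≤ 1) (hr : r ^ 2 ≤ 1) :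
    gaussianCoupling E (s ^ 2 * r) = (gaussianCoupling E r).map (s • ·) ∗
      (gaussianCoupling E 0).map (√(1 - s ^ 2) • ·) := by
  have h1 : IsProbabilityMeasure ((gaussianCoupling E r).map (s • ·)) :=
    Measure.isProbabilityMeasure_map (Measurable.aemeasurable (by fun_prop))
  have h2 : IsProbabilityMeasure ((gaussianCoupling E 0).map (√(1 - s ^ 2) • ·)) :=
    Measure.isProbabilityMeasure_map (Measurable.aemeasurable (by fun_prop))
  have hc : √(1 - s ^ 2) ^ 2 = 1 - s ^ 2 := Real.sq_sqrt (by linarith)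
  have hsr : (s ^ 2 * r) ^ 2 ≤ 1 := by
    rw [mul_pow]
    exact mul_le_one₀ (pow_le_one₀ (sq_nonneg s) hs) (sq_nonneg r) hr
  refine Measure.ext_of_charFun (funext fun t => ?_)
  rw [charFun_conv, charFun_map_smul, charFun_map_smul, charFun_gaussianCoupling hsr,
    charFun_gaussianCoupling hr, charFun_gaussianCoupling (by norm_num), ← Complex.ofReal_mul,
    ← Real.exp_add]
  congr 2
  simp only [smul_fst, smul_snd, norm_smul, mul_pow, Real.norm_eq_abs, sq_abs, hc,
    real_inner_smul_left, real_inner_smul_right]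
  ring

/-- The Ornstein–Uhlenbeck operator with correlation parameter `s = e^{-t}`, given by Mehler's
formula. -/
noncomputable def ornsteinUhlenbeck {F : Type*} [NormedAddCommGroup F] [NormedSpace ℝ F] (s : ℝ)
    (g : E → F) (x : E) : F :=
  ∫ y, g (s • x + √(1 - s ^ 2) • y) ∂(stdGaussian E)

lemma continuous_ornsteinUhlenbeck {F : Type*} [NormedAddCommGroup F] [NormedSpace ℝ F]
    [SecondCountableTopology F] {s : ℝ}
    {g : E → F} (hg : Continuous g) {K : ℝ} (hK : ∀ x, ‖g x‖ ≤ K) :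
    Continuous (ornsteinUhlenbeck s g) := by
  refine continuous_of_dominated (bound := fun _ => K) (fun x => ?_)
    (fun x => Eventually.of_forall fun y => hK _) (integrable_const _)
    (Eventually.of_forall fun y => by fun_prop)
  exact Continuous.aestronglyMeasurable (by fun_prop)

lemma norm_ornsteinUhlenbeck_le {F : Type*} [NormedAddCommGroup F] [NormedSpace ℝ F] {s : ℝ}
    {g : E → F} {K : ℝ} (hK : ∀ x, ‖g x‖ ≤ K) (x : E) : ‖ornsteinUhlenbeck s g x‖ ≤ K := by
  simpa [ornsteinUhlenbeck] using norm_integral_le_of_norm_le_const (μ := stdGaussian E)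
    (Eventually.of_forall fun y => hK (s • x + √(1 - s ^ 2) • y))

lemma integrable_of_continuous_bounded {α F : Type*} [TopologicalSpace α] [MeasurableSpace α]
    [OpensMeasurableSpace α] [NormedAddCommGroup F] [SecondCountableTopologyEither α F]
    {μ : Measure α} [IsFiniteMeasure μ] {g : α → F} (hg : Continuous g) {K : ℝ}
    (hK : ∀ x, ‖g x‖ ≤ K) : Integrable g μ :=
  Integrable.of_bound hg.aestronglyMeasurable K (Eventually.of_forall hK)

/-- The Ornstein–Uhlenbeck operators are `L¹` contractions. -/
lemma integral_norm_ornsteinUhlenbeck_le {F : Type*} [NormedAddCommGroup F] [NormedSpace ℝ F]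
    [SecondCountableTopology F] {s : ℝ} (hs : s ^ 2 ≤ 1)
    {g : E → F} (hg : Continuous g) {K : ℝ} (hK : ∀ x, ‖g x‖ ≤ K) :
    ∫ x, ‖ornsteinUhlenbeck s g x‖ ∂(stdGaussian E) ≤ ∫ x, ‖g x‖ ∂(stdGaussian E) := by
  have hint : Integrable (fun z : E × E => ‖g (s • z.1 + √(1 - s ^ 2) • z.2)‖)
      ((stdGaussian E).prod (stdGaussian E)) :=
    integrable_of_continuous_bounded (by fun_prop) (K := K) fun z => by simpa using hK _
  calc ∫ x, ‖ornsteinUhlenbeck s g x‖ ∂(stdGaussian E)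
      ≤ ∫ x, ∫ y, ‖g (s • x + √(1 - s ^ 2) • y)‖ ∂(stdGaussian E) ∂(stdGaussian E) := by
        refine integral_mono ?_ hint.integral_prod_left fun x => norm_integral_le_integral_norm _
        exact (integrable_of_continuous_bounded (continuous_ornsteinUhlenbeck hg hK)
          (norm_ornsteinUhlenbeck_le hK)).norm
    _ = ∫ z, ‖g (s • z.1 + √(1 - s ^ 2) • z.2)‖ ∂((stdGaussian E).prod (stdGaussian E)) :=
        (integral_prod _ hint).symm
    _ = ∫ x, ‖g x‖ ∂(stdGaussian E) := by
        conv_rhs => rw [← map_smul_add_smul_stdGaussian (E := E) (a := s) (b := √(1 - s ^ 2))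
          (by rw [Real.sq_sqrt (by linarith)]; ring)]
        rw [integral_map (Measurable.aemeasurable (by fun_prop))
          (Continuous.aestronglyMeasurable (by fun_prop))]

/-- The correlation `E⟨g(X), g(X')⟩` of a coupled pair, rewritten with part of the noise averaged
out in both arguments: the semigroup property and the symmetry of the Ornstein–Uhlenbeck
operators in one formula. -/
lemma integral_inner_gaussianCoupling_sq_mul {F : Type*} [NormedAddCommGroup F]
    [InnerProductSpace ℝ F] [CompleteSpace F] [SecondCountableTopology F] {s r : ℝ}
    (hs : s ^ 2 ≤ 1) (hr : r ^ 2 ≤ 1)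
    {g : E → F} (hg : Continuous g) {K : ℝ} (hK : ∀ x, ‖g x‖ ≤ K) :
    ∫ v, ⟪g v.fst, g v.snd⟫ ∂(gaussianCoupling E (s ^ 2 * r)) =
      ∫ v, ⟪ornsteinUhlenbeck s g v.fst, ornsteinUhlenbeck s g v.snd⟫
        ∂(gaussianCoupling E r) := by
  have h1 : IsProbabilityMeasure ((gaussianCoupling E r).map (s • ·)) :=
    Measure.isProbabilityMeasure_map (Measurable.aemeasurable (by fun_prop))
  have h2 : IsProbabilityMeasure ((gaussianCoupling E 0).map (√(1 - s ^ 2) • ·)) :=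
    Measure.isProbabilityMeasure_map (Measurable.aemeasurable (by fun_prop))
  have hbd : ∀ x y : E, ‖⟪g x, g y⟫‖ ≤ K * K := fun x y =>
    (norm_inner_le_norm _ _).trans (mul_le_mul (hK _) (hK _) (norm_nonneg _)
      ((norm_nonneg _).trans (hK x)))
  rw [gaussianCoupling_sq_mul hs hr, integral_conv]
  swap
  · exact integrable_of_continuous_bounded (by fun_prop) fun v => hbd _ _
  have hcont : Continuous fun z : WithLp 2 (E × E) × WithLp 2 (E × E) =>
      ⟪g (z.1 + z.2).fst, g (z.1 + z.2).snd⟫ := by fun_prop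
  have hcont2 : ∀ x : WithLp 2 (E × E), Continuous fun y : WithLp 2 (E × E) =>
      ⟪g (x + y).fst, g (x + y).snd⟫ := fun x => by fun_prop
  rw [integral_map (Measurable.aemeasurable (by fun_prop))]
  swap
  · exact hcont.stronglyMeasurable.integral_prod_right.aestronglyMeasurable
  refine integral_congr_ae (Eventually.of_forall fun v => ?_)
  simp only []
  rw [integral_map (Measurable.aemeasurable (by fun_prop)) (hcont2 _).aestronglyMeasurable,
    gaussianCoupling, integral_map (Measurable.aemeasurable (by fun_prop))
      (Continuous.aestronglyMeasurable (by fun_prop))]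
  simp only [WithLp.add_fst, WithLp.add_snd, WithLp.smul_fst, WithLp.smul_snd, toLp_fst, toLp_snd,
    zero_smul, zero_add, ne_eq, OfNat.ofNat_ne_zero, not_false_eq_true, zero_pow, sub_zero,
    Real.sqrt_one, one_smul]
  have hint : ∀ x : E, Integrable (fun y => g (x + √(1 - s ^ 2) • y)) (stdGaussian E) :=
    fun x => integrable_of_continuous_bounded (by fun_prop) fun y => hK _
  rw [integral_prod]
  swap
  · exact integrable_of_continuous_bounded (by fun_prop) fun v => hbd _ _
  simp only [integral_inner (hint _)]
  simp only [real_inner_comm (∫ y, g (s • v.snd + √(1 - s ^ 2) • y) ∂(stdGaussian E))]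
  rw [integral_inner (hint _), real_inner_comm]
  rfl

/-- Hypercontractivity for the correlation of a vector-valued function. -/
lemma integral_inner_gaussianCoupling_le_rpow {F : Type*} [NormedAddCommGroup F]
    [InnerProductSpace ℝ F] [SecondCountableTopology F] {ρ : ℝ} (h0 : 0 ≤ ρ) (h1 : ρ ≤ 1)
    {g : E → F} (hg : Continuous g) {K : ℝ} (hK : ∀ x, ‖g x‖ ≤ K) :
    ∫ v, ⟪g v.fst, g v.snd⟫ ∂(gaussianCoupling E ρ) ≤
      (∫ x, ‖g x‖ ^ (1 + ρ) ∂(stdGaussian E)) ^ (2 / (1 + ρ)) := by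
  have hK0 : 0 ≤ K := (norm_nonneg _).trans (hK 0)
  have hp : (0 : ℝ) < 1 + ρ := by linarith
  have hcoup := lintegral_gaussianCoupling_mul_le (E := E) h0 h1 (f := fun x => ‖g x‖₊)
    (g := fun x => ‖g x‖₊) (by fun_prop) (by fun_prop) (K := ⟨K, hK0⟩) hK hK
  have hpow : Continuous fun x => ‖g x‖ ^ (1 + ρ) :=
    (Real.continuous_rpow_const hp.le).comp (by fun_prop)
  have hpowint : Integrable (fun x => ‖g x‖ ^ (1 + ρ)) (stdGaussian E) := by
    refine integrable_of_continuous_bounded hpow (K := K ^ (1 + ρ)) fun x => ?_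
    rw [Real.norm_of_nonneg (by positivity)]
    exact Real.rpow_le_rpow (norm_nonneg _) (hK x) hp.le
  set I := ∫ x, ‖g x‖ ^ (1 + ρ) ∂(stdGaussian E) with hI
  have hI0 : 0 ≤ I := integral_nonneg fun x => by positivity
  have hmarg : ∫⁻ x, (‖g x‖₊ : ℝ≥0∞) ^ (1 + ρ) ∂(stdGaussian E) = ENNReal.ofReal I := by
    rw [hI, ofReal_integral_eq_lintegral_ofReal hpowint
      (Eventually.of_forall fun x => by positivity)]
    refine lintegral_congr fun x => ?_
    rw [← ENNReal.ofReal_rpow_of_nonneg (norm_nonneg _) hp.le, ← enorm_eq_nnnorm,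
      ofReal_norm]
  have hmeas : Measurable fun x => (‖g x‖₊ : ℝ≥0∞) ^ (1 + ρ) :=
    hg.nnnorm.measurable.coe_nnreal_ennreal.pow_const _
  have hfst : ∫⁻ v, (‖g v.fst‖₊ : ℝ≥0∞) ^ (1 + ρ) ∂(gaussianCoupling E ρ) =
      ENNReal.ofReal I := by
    rw [← hmarg, ← map_fst_gaussianCoupling (E := E) ρ, lintegral_map hmeas (by fun_prop)]
  have hsnd : ∫⁻ v, (‖g v.snd‖₊ : ℝ≥0∞) ^ (1 + ρ) ∂(gaussianCoupling E ρ) =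
      ENNReal.ofReal I := by
    rw [← hmarg, ← map_snd_gaussianCoupling (E := E) (ρ := ρ) (by nlinarith),
      lintegral_map hmeas (by fun_prop)]
  rw [hfst, hsnd, ← ENNReal.rpow_add_of_nonneg _ _ (by positivity) (by positivity), ← add_div,
    one_add_one_eq_two, ENNReal.ofReal_rpow_of_nonneg hI0 (by positivity)] at hcoup
  have hle : ∫ v, ⟪g v.fst, g v.snd⟫ ∂(gaussianCoupling E ρ) ≤
      ∫ v, ‖g v.fst‖ * ‖g v.snd‖ ∂(gaussianCoupling E ρ) := by
    have hb : ∀ v : WithLp 2 (E × E), ‖g v.fst‖ * ‖g v.snd‖ ≤ K * K := fun v =>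
      mul_le_mul (hK _) (hK _) (norm_nonneg _) hK0
    refine integral_mono (integrable_of_continuous_bounded (by fun_prop) (K := K * K) fun v =>
      (norm_inner_le_norm _ _).trans (hb v)) (integrable_of_continuous_bounded (by fun_prop)
      (K := K * K) fun v => ?_) fun v => real_inner_le_norm _ _
    rw [Real.norm_of_nonneg (by positivity)]
    exact hb v
  refine hle.trans ?_
  rw [integral_eq_lintegral_of_nonneg_ae (Eventually.of_forall fun v => by positivity)
    (Continuous.aestronglyMeasurable (by fun_prop))]
  refine ENNReal.toReal_le_of_le_ofReal (by positivity) (le_trans (le_of_eq ?_) hcoup)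
  refine lintegral_congr fun v => ?_
  rw [ENNReal.ofReal_mul (norm_nonneg _), ofReal_norm, ofReal_norm]
  rfl

/-- Correlation bound by interpolation: part of the noise makes `g` bounded by `B`, the rest is
used through hypercontractivity, and the intermediate norm is estimated by `L¹` and `L∞`. -/
lemma integral_inner_gaussianCoupling_le_of_bound {F : Type*} [NormedAddCommGroup F]
    [InnerProductSpace ℝ F] [CompleteSpace F] [SecondCountableTopology F] {s : ℝ}
    (hs : s ^ 2 ≤ 1)
    {g : E → F} (hg : Continuous g) {K : ℝ} (hK : ∀ x, ‖g x‖ ≤ K) {a B : ℝ}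
    (hB : ∀ x, ‖ornsteinUhlenbeck s g x‖ ≤ B) (ha : ∫ x, ‖g x‖ ∂(stdGaussian E) ≤ a) :
    ∫ v, ⟪g v.fst, g v.snd⟫ ∂(gaussianCoupling E (s ^ 4)) ≤
      (B ^ (s ^ 2) * a) ^ (2 / (1 + s ^ 2)) := by
  have hB0 : 0 ≤ B := (norm_nonneg _).trans (hB 0)
  have hcont := continuous_ornsteinUhlenbeck (s := s) hg hK
  rw [show s ^ 4 = s ^ 2 * s ^ 2 by ring, integral_inner_gaussianCoupling_sq_mul hs
    (pow_le_one₀ (sq_nonneg s) hs) hg hK]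
  refine (integral_inner_gaussianCoupling_le_rpow (sq_nonneg s) hs hcont hB).trans
    (Real.rpow_le_rpow (integral_nonneg fun x => by positivity) ?_ (by positivity))
  have hint : Integrable (fun x => ‖ornsteinUhlenbeck s g x‖) (stdGaussian E) :=
    (integrable_of_continuous_bounded hcont hB).norm
  calc ∫ x, ‖ornsteinUhlenbeck s g x‖ ^ (1 + s ^ 2) ∂(stdGaussian E)
      ≤ ∫ x, B ^ (s ^ 2) * ‖ornsteinUhlenbeck s g x‖ ∂(stdGaussian E) := by
        refine integral_mono_of_nonneg (Eventually.of_forall fun x => by positivity)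
          (hint.const_mul _) (Eventually.of_forall fun x => ?_)
        simp only []
        rw [add_comm, Real.rpow_add_of_nonneg (norm_nonneg _) (sq_nonneg s) zero_le_one,
          Real.rpow_one]
        exact mul_le_mul_of_nonneg_right
          (Real.rpow_le_rpow (norm_nonneg _) (hB x) (sq_nonneg s)) (norm_nonneg _)
    _ = B ^ (s ^ 2) * ∫ x, ‖ornsteinUhlenbeck s g x‖ ∂(stdGaussian E) := integral_const_mul _ _
    _ ≤ B ^ (s ^ 2) * a := by
        refine mul_le_mul_of_nonneg_left ?_ (by positivity)
        exact (integral_norm_ornsteinUhlenbeck_le hs hg hK).trans ha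

end OrnsteinUhlenbeck

/-! ### Gaussian integration by parts -/

section Gradient

open scoped RealInnerProductSpace

variable {E : Type*} [NormedAddCommGroup E] [InnerProductSpace ℝ E] [CompleteSpace E]

lemma inner_gradient_eq_fderiv (f : E → ℝ) (x w : E) : ⟪gradient f x, w⟫ = fderiv ℝ f x w :=
  inner_gradient_left

lemma norm_gradient_eq_norm_fderiv (f : E → ℝ) (x : E) : ‖gradient f x‖ = ‖fderiv ℝ f x‖ := by
  simp [gradient]

lemma ContDiff.continuous_gradient {f : E → ℝ} (hf : ContDiff ℝ 1 f) :
    Continuous (gradient f) :=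
  (InnerProductSpace.toDual ℝ E).symm.continuous.comp (hf.continuous_fderiv one_ne_zero)

end Gradient

section IntegrationByParts

open Filter Topology WithLp
open scoped RealInnerProductSpace

/-- Gaussian integration by parts on the line. -/
lemma integral_id_mul_gaussianReal {φ φ' : ℝ → ℝ} (hφ : ∀ x, HasDerivAt φ (φ' x) x)
    (hc : Continuous φ') {K K' : ℝ} (hK : ∀ x, ‖φ x‖ ≤ K) (hK' : ∀ x, ‖φ' x‖ ≤ K') :
    ∫ z, z * φ z ∂(gaussianReal 0 1) = ∫ z, φ' z ∂(gaussianReal 0 1) := by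
  have hφc : Continuous φ := continuous_iff_continuousAt.2 fun x => (hφ x).continuousAt
  rw [integral_gaussianReal_eq_integral_smul one_ne_zero,
    integral_gaussianReal_eq_integral_smul one_ne_zero]
  have hpdf : ∀ x, HasDerivAt (gaussianPDFReal 0 1) (-x * gaussianPDFReal 0 1 x) x := by
    intro x
    have h : HasDerivAt (fun x : ℝ => -(x - 0) ^ 2 / (2 * ((1 : ℝ≥0) : ℝ))) (-x) x := by
      refine ((((hasDerivAt_id x).sub_const 0).pow 2).neg.div_const _).congr_deriv ?_
      simp
      ring
    exact (h.exp.const_mul (√(2 * Real.pi * ((1 : ℝ≥0) : ℝ)))⁻¹).congr_deriv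
      (by rw [gaussianPDFReal]; ring)
  have hg := integrable_gaussianPDFReal 0 1
  have hg' : Integrable (fun x => -x * gaussianPDFReal 0 1 x) := by
    refine ((integrable_mul_exp_neg_mul_sq (b := 1 / 2) (by norm_num)).const_mul
      (-(√(2 * Real.pi * ((1 : ℝ≥0) : ℝ)))⁻¹)).congr (Eventually.of_forall fun x => ?_)
    simp only [gaussianPDFReal, NNReal.coe_one, sub_zero, mul_one]
    rw [show -(1 / 2) * x ^ 2 = -x ^ 2 / 2 by ring]
    ring
  have := integral_mul_deriv_eq_deriv_mul_of_integrable (u := φ) (v := gaussianPDFReal 0 1)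
    (u' := φ') (v' := fun x => -x * gaussianPDFReal 0 1 x) (fun x _ => hφ x) (fun x _ => hpdf x)
    (hg'.bdd_mul hφc.aestronglyMeasurable (Eventually.of_forall hK))
    (hg.bdd_mul hc.aestronglyMeasurable (Eventually.of_forall hK'))
    (hg.bdd_mul hφc.aestronglyMeasurable (Eventually.of_forall hK))
  calc ∫ x, gaussianPDFReal 0 1 x • (x * φ x) = -∫ x, φ x * (-x * gaussianPDFReal 0 1 x) := by
        rw [← integral_neg]
        refine integral_congr_ae (Eventually.of_forall fun x => ?_)
        simp only [smul_eq_mul]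
        ring
    _ = ∫ x, gaussianPDFReal 0 1 x • φ' x := by
        rw [this, neg_neg]
        refine integral_congr_ae (Eventually.of_forall fun x => ?_)
        simp only [smul_eq_mul]
        ring

variable {E : Type*} [NormedAddCommGroup E] [InnerProductSpace ℝ E] [FiniteDimensional ℝ E]
  [MeasurableSpace E] [BorelSpace E]

/-- The component of a standard Gaussian vector along a unit vector is an independent standard
Gaussian variable, so it can be resampled. -/
lemma map_resample_stdGaussian {v : E} (hv : ‖v‖ = 1) :
    ((stdGaussian E).prod (gaussianReal 0 1)).map (fun z => (z.1 - ⟪v, z.1⟫ • v) + z.2 • v) =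
      stdGaussian E := by
  have : IsProbabilityMeasure (((stdGaussian E).prod (gaussianReal 0 1)).map
      (fun z => (z.1 - ⟪v, z.1⟫ • v) + z.2 • v)) :=
    Measure.isProbabilityMeasure_map (Measurable.aemeasurable (by fun_prop))
  refine Measure.ext_of_charFun (funext fun t => ?_)
  rw [charFun_apply, integral_map (Measurable.aemeasurable (by fun_prop))
    (Measurable.aestronglyMeasurable (by fun_prop))]
  have e : ∀ z : E × ℝ, Complex.exp (⟪(z.1 - ⟪v, z.1⟫ • v) + z.2 • v, t⟫ * Complex.I) =
      Complex.exp (⟪z.1, t - ⟪v, t⟫ • v⟫ * Complex.I) *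
        Complex.exp ((⟪v, t⟫ : ℝ) * z.2 * Complex.I) := by
    intro z
    rw [← Complex.exp_add, ← add_mul, ← Complex.ofReal_mul, ← Complex.ofReal_add]
    congr 3
    simp only [inner_add_left, inner_sub_left, inner_sub_right, real_inner_smul_left,
      real_inner_smul_right, real_inner_comm z.1 v]
    ring
  simp_rw [e]
  rw [integral_prod_mul (fun x : E => Complex.exp (⟪x, t - ⟪v, t⟫ • v⟫ * Complex.I))
    (fun y : ℝ => Complex.exp ((⟪v, t⟫ : ℝ) * y * Complex.I)),
    ← charFun_apply, ← charFun_apply_real, charFun_stdGaussian, charFun_stdGaussian,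
    charFun_gaussianReal, ← Complex.exp_add]
  congr 1
  rw [← Complex.ofReal_pow, ← Complex.ofReal_pow, norm_sub_sq_real, norm_smul, mul_pow, hv,
    real_inner_smul_right, Real.norm_eq_abs, sq_abs, real_inner_comm v t]
  push_cast
  ring

lemma integral_inner_mul_stdGaussian_of_norm_eq_one {u : E → ℝ} (hu : ContDiff ℝ 1 u)
    {K K' : ℝ} (hK : ∀ x, ‖u x‖ ≤ K) (hK' : ∀ x, ‖fderiv ℝ u x‖ ≤ K') {v : E} (hv : ‖v‖ = 1) :
    ∫ y, ⟪v, y⟫ * u y ∂(stdGaussian E) = ∫ y, fderiv ℝ u y v ∂(stdGaussian E) := by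
  have hder : Continuous fun y => fderiv ℝ u y v :=
    (hu.continuous_fderiv one_ne_zero).clm_apply continuous_const
  have hucont := hu.continuous
  have hlin : Integrable (fun y => ⟪v, y⟫ * u y) (stdGaussian E) := by
    refine Integrable.mul_bdd (c := K) ?_ hucont.aestronglyMeasurable (Eventually.of_forall hK)
    exact (IsGaussian.memLp_dual (stdGaussian E) (innerSL ℝ v) 1 (by simp)).integrable le_rfl
  have hder_bd : ∀ y, ‖fderiv ℝ u y v‖ ≤ K' := fun y => by
    simpa [hv] using ((fderiv ℝ u y).le_opNorm v).trans
      (mul_le_mul_of_nonneg_right (hK' y) (norm_nonneg v))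
  have hm := map_resample_stdGaussian (E := E) hv
  have hmeas : Measurable fun z : E × ℝ => (z.1 - ⟪v, z.1⟫ • v) + z.2 • v := by fun_prop
  have hlin' := hlin
  rw [← hm] at hlin'
  rw [integrable_map_measure (Continuous.aestronglyMeasurable (by fun_prop)) hmeas.aemeasurable]
    at hlin'
  simp only [Function.comp_def] at hlin'
  conv_lhs => rw [← hm]
  conv_rhs => rw [← hm]
  rw [integral_map hmeas.aemeasurable (Continuous.aestronglyMeasurable (by fun_prop)),
    integral_map hmeas.aemeasurable (Continuous.aestronglyMeasurable (by fun_prop)),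
    integral_prod _ hlin', integral_prod]
  swap
  · exact integrable_of_continuous_bounded (by fun_prop) fun z => hder_bd _
  refine integral_congr_ae (Eventually.of_forall fun y => ?_)
  simp only []
  have h1 : ∀ z : ℝ, ⟪v, (y - ⟪v, y⟫ • v) + z • v⟫ = z := by
    intro z
    rw [inner_add_right, inner_sub_right, real_inner_smul_right, real_inner_smul_right,
      real_inner_self_eq_norm_sq, hv]
    ring
  simp only [h1]
  refine integral_id_mul_gaussianReal (φ := fun z => u ((y - ⟪v, y⟫ • v) + z • v)) (fun z => ?_)
    (by fun_prop) (fun z => hK _) fun z => hder_bd _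
  have hl : HasDerivAt (fun z : ℝ => (y - ⟪v, y⟫ • v) + z • v) v z := by
    simpa using ((hasDerivAt_id z).smul_const v).const_add (y - ⟪v, y⟫ • v)
  exact ((hu.differentiable one_ne_zero _).hasFDerivAt).comp_hasDerivAt z hl

/-- Gaussian integration by parts. -/
lemma integral_inner_mul_stdGaussian {u : E → ℝ} (hu : ContDiff ℝ 1 u)
    {K K' : ℝ} (hK : ∀ x, ‖u x‖ ≤ K) (hK' : ∀ x, ‖fderiv ℝ u x‖ ≤ K') (w : E) :
    ∫ y, ⟪w, y⟫ * u y ∂(stdGaussian E) = ∫ y, fderiv ℝ u y w ∂(stdGaussian E) := by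
  rcases eq_or_ne w 0 with rfl | hw
  · simp
  have hv : ‖‖w‖⁻¹ • w‖ = 1 := by simp [norm_smul, hw]
  have := integral_inner_mul_stdGaussian_of_norm_eq_one hu hK hK' hv
  simp only [real_inner_smul_left, map_smul, smul_eq_mul, mul_assoc, integral_const_mul] at this
  exact mul_left_cancel₀ (inv_ne_zero (norm_ne_zero_iff.2 hw)) this

lemma integral_abs_inner_stdGaussian_le (w : E) :
    ∫ y, |⟪w, y⟫| ∂(stdGaussian E) ≤ ‖w‖ := by
  rcases eq_or_ne w 0 with rfl | hw
  · simp
  have hw' : 0 < ‖w‖ := norm_pos_iff.2 hw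
  have h2 : MemLp (fun y => ⟪w, y⟫) 2 (stdGaussian E) :=
    IsGaussian.memLp_dual (stdGaussian E) (innerSL ℝ w) 2 (by simp)
  have hsq : ∫ y, ⟪w, y⟫ ^ 2 ∂(stdGaussian E) = ‖w‖ ^ 2 := by
    have h := variance_dual_stdGaussian (innerSL ℝ w)
    rw [variance_of_integral_eq_zero (by fun_prop) (integral_strongDual_stdGaussian _),
      innerSL_apply_norm] at h
    exact h
  calc ∫ y, |⟪w, y⟫| ∂(stdGaussian E)
      ≤ ∫ y, (⟪w, y⟫ ^ 2 * (2 * ‖w‖)⁻¹ + ‖w‖ / 2) ∂(stdGaussian E) := by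
        refine integral_mono (h2.integrable (by simp)).abs
          ((h2.integrable_sq.mul_const _).add (integrable_const _)) fun y => ?_
        simp only []
        rw [← sub_nonneg, show ⟪w, y⟫ ^ 2 * (2 * ‖w‖)⁻¹ + ‖w‖ / 2 - |⟪w, y⟫| =
          (|⟪w, y⟫| - ‖w‖) ^ 2 / (2 * ‖w‖) by rw [← sq_abs ⟪w, y⟫]; field_simp; ring]
        positivity
    _ = ‖w‖ := by
        rw [integral_add (h2.integrable_sq.mul_const _) (integrable_const _),
          integral_mul_const, hsq]
        simp
        field_simp
        ring

/-- The regularizing effect of the Ornstein–Uhlenbeck semigroup on bounded functions, in a form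
where the gradient is taken before averaging. -/
lemma norm_ornsteinUhlenbeck_gradient_le {f : E → ℝ} (hf : ContDiff ℝ 1 f)
    (h1 : ∀ x, |f x| ≤ 1) {K' : ℝ} (hK' : ∀ x, ‖fderiv ℝ f x‖ ≤ K') {s : ℝ} (hs : s ^ 2 < 1)
    (x : E) : ‖ornsteinUhlenbeck s (gradient f) x‖ ≤ (√(1 - s ^ 2))⁻¹ := by
  set c := √(1 - s ^ 2) with hc
  have hcpos : 0 < c := Real.sqrt_pos.2 (by linarith)
  set m := ornsteinUhlenbeck s (gradient f) x with hm
  have hgc := hf.continuous_gradient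
  have haff : ∀ y : E, HasFDerivAt (fun y : E => s • x + c • y)
      (c • ContinuousLinearMap.id ℝ E) y := fun y =>
    ((hasFDerivAt_id y).const_smul c).const_add _
  have hfd : ∀ y w : E, fderiv ℝ (fun y => f (s • x + c • y)) y w =
      c * ⟪w, gradient f (s • x + c • y)⟫ := by
    intro y w
    have hcomp : HasFDerivAt (fun y => f (s • x + c • y)) _ y :=
      (hf.differentiable one_ne_zero _).hasFDerivAt.comp y (haff y)
    rw [hcomp.fderiv, real_inner_comm, inner_gradient_eq_fderiv]
    simp
  have hbd : ∀ y : E, ‖fderiv ℝ (fun y => f (s • x + c • y)) y‖ ≤ c * K' := by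
    intro y
    refine ContinuousLinearMap.opNorm_le_bound _
      (mul_nonneg hcpos.le ((norm_nonneg _).trans (hK' 0))) fun w => ?_
    rw [hfd, norm_mul, Real.norm_of_nonneg hcpos.le, mul_assoc]
    refine mul_le_mul_of_nonneg_left ((norm_inner_le_norm _ _).trans ?_) hcpos.le
    rw [mul_comm, norm_gradient_eq_norm_fderiv]
    exact mul_le_mul_of_nonneg_right (hK' _) (norm_nonneg _)
  have hibp := integral_inner_mul_stdGaussian (u := fun y => f (s • x + c • y)) (K := 1)
    (by fun_prop) (fun y => h1 _) hbd m
  have hint : Integrable (fun y => gradient f (s • x + c • y)) (stdGaussian E) :=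
    integrable_of_continuous_bounded (by fun_prop) (K := K') fun y => by
      rw [norm_gradient_eq_norm_fderiv]; exact hK' _
  simp only [hfd, integral_const_mul] at hibp
  rw [integral_inner hint] at hibp
  have hmm : ⟪m, m⟫ = ‖m‖ ^ 2 := real_inner_self_eq_norm_sq m
  have e : ∫ y, gradient f (s • x + c • y) ∂(stdGaussian E) = m := rfl
  rw [e, hmm] at hibp
  have hL : Integrable (fun y => ⟪m, y⟫) (stdGaussian E) :=
    (IsGaussian.memLp_dual (stdGaussian E) (innerSL ℝ m) 1 (by simp)).integrable le_rfl
  have hle : c * ‖m‖ ^ 2 ≤ ‖m‖ := by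
    rw [← hibp]
    refine le_trans (integral_mono (hL.mul_bdd (c := 1)
      (Continuous.aestronglyMeasurable (by fun_prop)) (Eventually.of_forall fun y => h1 _))
      hL.abs fun y => ?_) (integral_abs_inner_stdGaussian_le m)
    calc ⟪m, y⟫ * f (s • x + c • y) ≤ |⟪m, y⟫ * f (s • x + c • y)| := le_abs_self _
      _ ≤ |⟪m, y⟫| := by
        rw [abs_mul]
        exact mul_le_of_le_one_right (abs_nonneg _) (h1 _)
  rw [← one_div, le_div_iff₀ hcpos]
  rcases (norm_nonneg m).eq_or_lt with h | h
  · rw [← h]; simp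
  · have : ‖m‖ * (‖m‖ * c) ≤ ‖m‖ * 1 := by linarith [sq (‖m‖)]
    exact le_of_mul_le_mul_left this h

lemma norm_ornsteinUhlenbeck_starProjection_gradient_le (Q : Submodule ℝ E) {f : E → ℝ}
    (hf : ContDiff ℝ 1 f) (h1 : ∀ x, |f x| ≤ 1) {K' : ℝ} (hK' : ∀ x, ‖fderiv ℝ f x‖ ≤ K')
    {s : ℝ} (hs : s ^ 2 < 1) (x : E) :
    ‖ornsteinUhlenbeck s (fun x => Q.starProjection (gradient f x)) x‖ ≤
      (√(1 - s ^ 2))⁻¹ := by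
  have hgc := hf.continuous_gradient
  have hint : Integrable (fun y => gradient f (s • x + √(1 - s ^ 2) • y)) (stdGaussian E) :=
    integrable_of_continuous_bounded (by fun_prop) (K := K') fun y => by
      rw [norm_gradient_eq_norm_fderiv]; exact hK' _
  have e : ornsteinUhlenbeck s (fun x => Q.starProjection (gradient f x)) x =
      Q.starProjection (ornsteinUhlenbeck s (gradient f) x) :=
    Q.starProjection.integral_comp_comm hint
  rw [e]
  exact (Q.norm_starProjection_apply_le _).trans
    (norm_ornsteinUhlenbeck_gradient_le hf h1 hK' hs x)

end IntegrationByParts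

/-! ### The variance as an integral of gradient correlations -/

section VarianceFormula

open Filter Topology WithLp
open scoped RealInnerProductSpace

section

variable {E : Type*} [NormedAddCommGroup E] [InnerProductSpace ℝ E]

lemma norm_smul_add_smul_le {a b : ℝ} (ha : |a| ≤ 1) (hb : |b| ≤ 1) (x y : E) :
    ‖a • x + b • y‖ ≤ ‖x‖ + ‖y‖ := by
  refine (norm_add_le _ _).trans (add_le_add ?_ ?_)
  · rw [norm_smul]; exact mul_le_of_le_one_left (norm_nonneg _) ha
  · rw [norm_smul]; exact mul_le_of_le_one_left (norm_nonneg _) hb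

lemma norm_rotation_deriv_le {f : E → ℝ} {K K' : ℝ} (hK : ∀ x, ‖f x‖ ≤ K)
    (hK' : ∀ x, ‖fderiv ℝ f x‖ ≤ K') (θ : ℝ) (z : E × E) :
    ‖f z.1 * fderiv ℝ f (Real.cos θ • z.1 + Real.sin θ • z.2)
      (-Real.sin θ • z.1 + Real.cos θ • z.2)‖ ≤ K * (K' * (‖z.1‖ + ‖z.2‖)) := by
  have hK'0 : 0 ≤ K' := (norm_nonneg _).trans (hK' 0)
  have hK0 : 0 ≤ K := (norm_nonneg _).trans (hK 0)
  rw [norm_mul]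
  refine mul_le_mul (hK _) ?_ (norm_nonneg _) hK0
  refine (ContinuousLinearMap.le_opNorm _ _).trans (mul_le_mul (hK' _) ?_ (norm_nonneg _) hK'0)
  exact norm_smul_add_smul_le (by rw [abs_neg]; exact Real.abs_sin_le_one θ)
    (Real.abs_cos_le_one θ) _ _

lemma continuous_rotation_deriv {f : E → ℝ} (hf : ContDiff ℝ 1 f) :
    Continuous fun q : ℝ × (E × E) => f q.2.1 *
      fderiv ℝ f (Real.cos q.1 • q.2.1 + Real.sin q.1 • q.2.2)
        (-Real.sin q.1 • q.2.1 + Real.cos q.1 • q.2.2) := by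
  have h1 := hf.continuous
  have h2 := hf.continuous_fderiv one_ne_zero
  exact (h1.comp (by fun_prop)).mul ((h2.comp (by fun_prop)).clm_apply (by fun_prop))

end

variable {E : Type*} [NormedAddCommGroup E] [InnerProductSpace ℝ E] [FiniteDimensional ℝ E]
  [MeasurableSpace E] [BorelSpace E]

lemma integrable_norm_add_norm_stdGaussian_prod :
    Integrable (fun z : E × E => ‖z.1‖ + ‖z.2‖) ((stdGaussian E).prod (stdGaussian E)) := by
  have h : Integrable (fun x : E => ‖x‖) (stdGaussian E) :=
    (IsGaussian.integrable_id (μ := stdGaussian E)).norm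
  exact (h.comp_fst _).add (h.comp_snd _)

lemma continuous_integral_rotation_deriv {f : E → ℝ} (hf : ContDiff ℝ 1 f) {K K' : ℝ} (hK : ∀ x, ‖f x‖ ≤ K)
    (hK' : ∀ x, ‖fderiv ℝ f x‖ ≤ K') :
    Continuous fun θ : ℝ => ∫ z, f z.1 *
      fderiv ℝ f (Real.cos θ • z.1 + Real.sin θ • z.2) (-Real.sin θ • z.1 + Real.cos θ • z.2)
        ∂((stdGaussian E).prod (stdGaussian E)) := by
  have hc := continuous_rotation_deriv hf
  refine continuous_of_dominated (bound := fun z => K * (K' * (‖z.1‖ + ‖z.2‖)))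
    (fun θ => ?_) (fun θ => Eventually.of_forall fun z => norm_rotation_deriv_le hK hK' θ z)
    ((integrable_norm_add_norm_stdGaussian_prod.const_mul _).const_mul _)
    (Eventually.of_forall fun z => ?_)
  · exact (hc.comp (Continuous.prodMk_right θ)).aestronglyMeasurable
  · exact hc.comp (Continuous.prodMk_left z)

lemma hasDerivAt_integral_rotation {f : E → ℝ} (hf : ContDiff ℝ 1 f) {K K' : ℝ} (hK : ∀ x, ‖f x‖ ≤ K)
    (hK' : ∀ x, ‖fderiv ℝ f x‖ ≤ K')
    (θ : ℝ) :
    HasDerivAt (fun θ : ℝ => ∫ z, f z.1 * f (Real.cos θ • z.1 + Real.sin θ • z.2)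
        ∂((stdGaussian E).prod (stdGaussian E)))
      (∫ z, f z.1 * fderiv ℝ f (Real.cos θ • z.1 + Real.sin θ • z.2)
        (-Real.sin θ • z.1 + Real.cos θ • z.2) ∂((stdGaussian E).prod (stdGaussian E))) θ := by
  have hfc := hf.continuous
  have hc := continuous_rotation_deriv hf
  let F : ℝ → E × E → ℝ := fun θ z => f z.1 * f (Real.cos θ • z.1 + Real.sin θ • z.2)
  let F' : ℝ → E × E → ℝ := fun θ z => f z.1 *
    fderiv ℝ f (Real.cos θ • z.1 + Real.sin θ • z.2) (-Real.sin θ • z.1 + Real.cos θ • z.2)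
  have hF : ∀ θ, Continuous (F θ) := fun θ => by fun_prop
  have hFint : Integrable (F θ) ((stdGaussian E).prod (stdGaussian E)) := by
    refine integrable_of_continuous_bounded (hF θ) (K := K * K) fun z => ?_
    rw [norm_mul]
    exact mul_le_mul (hK _) (hK _) (norm_nonneg _) ((norm_nonneg _).trans (hK 0))
  have hder : ∀ z θ, HasDerivAt (fun θ => F θ z) (F' θ z) θ := by
    intro z θ
    have hcurve : HasDerivAt (fun θ : ℝ => Real.cos θ • z.1 + Real.sin θ • z.2)
        (-Real.sin θ • z.1 + Real.cos θ • z.2) θ :=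
      ((Real.hasDerivAt_cos θ).smul_const z.1).add ((Real.hasDerivAt_sin θ).smul_const z.2)
    exact ((hf.differentiable one_ne_zero _).hasFDerivAt.comp_hasDerivAt θ hcurve).const_mul _
  exact (hasDerivAt_integral_of_dominated_loc_of_deriv_le (F := F) (F' := F') (s := Set.univ)
    (bound := fun z => K * (K' * (‖z.1‖ + ‖z.2‖))) univ_mem
    (Eventually.of_forall fun θ => (hF θ).aestronglyMeasurable) hFint
    (hc.comp (Continuous.prodMk_right θ)).aestronglyMeasurable
    (Eventually.of_forall fun z θ _ => norm_rotation_deriv_le hK hK' θ z)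
    ((integrable_norm_add_norm_stdGaussian_prod.const_mul _).const_mul _)
    (Eventually.of_forall fun z θ _ => hder z θ)).2

/-- After rotating the pair `(X, Y)`, only an integration by parts in the second variable is
needed, so no second derivatives of `f` appear. -/
lemma integral_rotation_deriv_eq {f : E → ℝ} (hf : ContDiff ℝ 1 f) {K K' : ℝ} (hK : ∀ x, ‖f x‖ ≤ K)
    (hK' : ∀ x, ‖fderiv ℝ f x‖ ≤ K')
    {θ : ℝ} (hθ : 0 ≤ Real.sin θ) :
    ∫ z, f z.1 * fderiv ℝ f (Real.cos θ • z.1 + Real.sin θ • z.2)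
        (-Real.sin θ • z.1 + Real.cos θ • z.2) ∂((stdGaussian E).prod (stdGaussian E)) =
      -(Real.sin θ * ∫ v, ⟪gradient f v.fst, gradient f v.snd⟫
        ∂(gaussianCoupling E (Real.cos θ))) := by
  have hfc := hf.continuous
  have hgc := hf.continuous_gradient
  have hdc := hf.continuous_fderiv one_ne_zero
  have hrot : ((stdGaussian E).prod (stdGaussian E)).map (ContinuousLinearMap.rotation θ) =
      (stdGaussian E).prod (stdGaussian E) :=
    IsGaussian.map_rotation_eq_self integral_id_stdGaussian θ
  have hsc := Real.sin_sq_add_cos_sq θ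
  let G : E × E → ℝ := fun z =>
    f (Real.cos θ • z.1 - Real.sin θ • z.2) * fderiv ℝ f z.1 z.2
  have hGc : Continuous G :=
    (hfc.comp (by fun_prop)).mul ((hdc.comp continuous_fst).clm_apply continuous_snd)
  have hGrot : ∀ z : E × E, f z.1 * fderiv ℝ f (Real.cos θ • z.1 + Real.sin θ • z.2)
        (-Real.sin θ • z.1 + Real.cos θ • z.2) = G (ContinuousLinearMap.rotation θ z) := by
    intro z
    simp only [G, ContinuousLinearMap.rotation_apply]
    congr 2
    have h1 : Real.cos θ • (Real.cos θ • z.1 + Real.sin θ • z.2) -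
        Real.sin θ • (-Real.sin θ • z.1 + Real.cos θ • z.2) =
        (Real.sin θ ^ 2 + Real.cos θ ^ 2) • z.1 := by module
    rw [h1, hsc, one_smul]
  have hGint : Integrable G ((stdGaussian E).prod (stdGaussian E)) := by
    rw [← hrot, integrable_map_measure hGc.aestronglyMeasurable (by fun_prop)]
    have hc := continuous_rotation_deriv hf
    refine Integrable.mono' ((integrable_norm_add_norm_stdGaussian_prod.const_mul K').const_mul K)
      (hGc.comp (ContinuousLinearMap.continuous _)).aestronglyMeasurable
      (Eventually.of_forall fun z => ?_)
    rw [Function.comp_apply, ← hGrot]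
    exact norm_rotation_deriv_le hK hK' θ z
  have hneg : (stdGaussian E).map (fun y => -y) = stdGaussian E :=
    stdGaussian_map (LinearIsometryEquiv.neg ℝ)
  have hbd : ∀ x y : E, ‖⟪gradient f x, gradient f y⟫‖ ≤ K' * K' := fun x y =>
    (norm_inner_le_norm _ _).trans (by
      rw [norm_gradient_eq_norm_fderiv, norm_gradient_eq_norm_fderiv]
      exact mul_le_mul (hK' _) (hK' _) (norm_nonneg _) ((norm_nonneg _).trans (hK' 0)))
  calc _ = ∫ z, G (ContinuousLinearMap.rotation θ z) ∂((stdGaussian E).prod (stdGaussian E)) :=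
        integral_congr_ae (Eventually.of_forall hGrot)
    _ = ∫ z, G z ∂((stdGaussian E).prod (stdGaussian E)) := by
        conv_rhs => rw [← hrot]
        rw [integral_map (by fun_prop) hGc.aestronglyMeasurable]
    _ = ∫ x, ∫ y, G (x, y) ∂(stdGaussian E) ∂(stdGaussian E) := integral_prod _ hGint
    _ = ∫ x, ∫ y, -(Real.sin θ * ⟪gradient f x, gradient f (Real.cos θ • x + Real.sin θ • y)⟫)
          ∂(stdGaussian E) ∂(stdGaussian E) := by
        refine integral_congr_ae (Eventually.of_forall fun x => ?_)
        simp only [G]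
        have hfd : ∀ y w : E, fderiv ℝ (fun y => f (Real.cos θ • x - Real.sin θ • y)) y w =
            -(Real.sin θ * fderiv ℝ f (Real.cos θ • x - Real.sin θ • y) w) := by
          intro y w
          have hcomp : HasFDerivAt (fun y => f (Real.cos θ • x - Real.sin θ • y)) _ y :=
            (hf.differentiable one_ne_zero _).hasFDerivAt.comp y
              (((hasFDerivAt_id y).const_smul (Real.sin θ)).const_sub (Real.cos θ • x))
          rw [hcomp.fderiv]
          simp
        have hfdbd : ∀ y : E, ‖fderiv ℝ (fun y => f (Real.cos θ • x - Real.sin θ • y)) y‖ ≤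
            K' := by
          intro y
          refine ContinuousLinearMap.opNorm_le_bound _ ((norm_nonneg _).trans (hK' 0)) fun w => ?_
          rw [hfd, norm_neg, norm_mul]
          refine (mul_le_of_le_one_left (norm_nonneg _) (Real.abs_sin_le_one θ)).trans ?_
          exact ((fderiv ℝ f _).le_opNorm w).trans
            (mul_le_mul_of_nonneg_right (hK' _) (norm_nonneg _))
        have hibp := integral_inner_mul_stdGaussian
          (u := fun y => f (Real.cos θ • x - Real.sin θ • y)) (by fun_prop) (fun y => hK _) hfdbd
          (gradient f x)
        simp only [hfd, inner_gradient_eq_fderiv] at hibp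
        simp only [mul_comm (f _)]
        rw [hibp]
        conv_lhs => rw [← hneg]
        have hmeas : Continuous fun y => -(Real.sin θ *
            fderiv ℝ f (Real.cos θ • x - Real.sin θ • y) (gradient f x)) := by
          exact (continuous_const.mul ((hdc.comp (by fun_prop)).clm_apply continuous_const)).neg
        rw [integral_map (by fun_prop) hmeas.aestronglyMeasurable]
        refine integral_congr_ae (Eventually.of_forall fun y => ?_)
        simp only [smul_neg, sub_neg_eq_add]
        rw [← inner_gradient_eq_fderiv, real_inner_comm]
    _ = -(Real.sin θ * ∫ z, ⟪gradient f z.1, gradient f (Real.cos θ • z.1 + Real.sin θ • z.2)⟫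
          ∂((stdGaussian E).prod (stdGaussian E))) := by
        rw [integral_prod]
        · simp only [integral_neg, integral_const_mul]
        · exact integrable_of_continuous_bounded (by fun_prop) fun z => hbd _ _
    _ = _ := by
        rw [gaussianCoupling, integral_map (Measurable.aemeasurable (by fun_prop))
          (Continuous.aestronglyMeasurable (by fun_prop))]
        have : √(1 - Real.cos θ ^ 2) = Real.sin θ := by
          rw [show 1 - Real.cos θ ^ 2 = Real.sin θ ^ 2 by linarith, Real.sqrt_sq hθ]
        simp only [this, toLp_fst, toLp_snd]

lemma intervalIntegrable_sin_mul_correlation {f : E → ℝ} (hf : ContDiff ℝ 1 f) {K K' : ℝ} (hK : ∀ x, ‖f x‖ ≤ K)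
    (hK' : ∀ x, ‖fderiv ℝ f x‖ ≤ K') :
    IntervalIntegrable (fun θ => Real.sin θ * ∫ v, ⟪gradient f v.fst, gradient f v.snd⟫
        ∂(gaussianCoupling E (Real.cos θ))) volume 0 (Real.pi / 2) := by
  refine ((continuous_integral_rotation_deriv hf hK hK').neg.intervalIntegrable 0
    (Real.pi / 2)).congr_uIoo fun θ hθ => ?_
  rw [Set.uIoo_of_le (by positivity)] at hθ
  rw [Pi.neg_apply, integral_rotation_deriv_eq hf hK hK'
    (Real.sin_nonneg_of_nonneg_of_le_pi hθ.1.le (by linarith [hθ.2, Real.pi_pos])), neg_neg]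

/-- The variance is the integral of the correlations of the gradient at two points rotated by an
angle `θ` from each other. -/
lemma variance_eq_integral_correlation {f : E → ℝ} (hf : ContDiff ℝ 1 f) {K K' : ℝ} (hK : ∀ x, ‖f x‖ ≤ K)
    (hK' : ∀ x, ‖fderiv ℝ f x‖ ≤ K') :
    variance f (stdGaussian E) = ∫ θ in (0 : ℝ)..(Real.pi / 2), Real.sin θ *
      ∫ v, ⟪gradient f v.fst, gradient f v.snd⟫ ∂(gaussianCoupling E (Real.cos θ)) := by
  have hfc := hf.continuous
  have hfint : Integrable f (stdGaussian E) := integrable_of_continuous_bounded hfc hK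
  have hftc := intervalIntegral.integral_eq_sub_of_hasDerivAt (a := 0) (b := Real.pi / 2)
    (fun θ _ => hasDerivAt_integral_rotation hf hK hK' θ)
    ((continuous_integral_rotation_deriv hf hK hK').intervalIntegrable _ _)
  have hcongr : ∫ θ in (0 : ℝ)..(Real.pi / 2), ∫ z, f z.1 *
      fderiv ℝ f (Real.cos θ • z.1 + Real.sin θ • z.2) (-Real.sin θ • z.1 + Real.cos θ • z.2)
        ∂((stdGaussian E).prod (stdGaussian E)) =
      ∫ θ in (0 : ℝ)..(Real.pi / 2), -(Real.sin θ *
        ∫ v, ⟪gradient f v.fst, gradient f v.snd⟫ ∂(gaussianCoupling E (Real.cos θ))) := by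
    refine intervalIntegral.integral_congr fun θ hθ => ?_
    rw [Set.uIcc_of_le (by positivity)] at hθ
    exact integral_rotation_deriv_eq hf hK hK'
      (Real.sin_nonneg_of_nonneg_of_le_pi hθ.1 (by linarith [hθ.2, Real.pi_pos]))
  rw [hcongr, intervalIntegral.integral_neg] at hftc
  simp only [Real.cos_pi_div_two, Real.sin_pi_div_two, zero_smul, one_smul, zero_add,
    Real.cos_zero, Real.sin_zero, add_zero] at hftc
  rw [integral_prod_mul f f] at hftc
  have hsq : ∫ z : E × E, f z.1 * f z.1 ∂((stdGaussian E).prod (stdGaussian E)) =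
      ∫ x, f x * f x ∂(stdGaussian E) := by
    rw [integral_fun_fst (fun x => f x * f x)]
    simp
  rw [hsq] at hftc
  rw [variance_eq_sub (MemLp.of_bound hfc.aestronglyMeasurable K (Eventually.of_forall hK))]
  have e : ∫ x, (f ^ 2) x ∂(stdGaussian E) = ∫ x, f x * f x ∂(stdGaussian E) :=
    integral_congr_ae (Eventually.of_forall fun x => by simp [sq])
  rw [e, sq]
  linarith

end VarianceFormula

/-! ### The estimate for one subspace -/

section Estimate

open Filter Topology WithLp
open scoped RealInnerProductSpace

/-- Here `q = s²` with `s⁴ = cos θ`. The factor `sin θ` compensates the blow-up at `θ = 0` of the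
uniform bound `(1 - q)^{-1/2}` of the smoothed gradient. -/
lemma sin_mul_rpow_le_mul_rpow {θ q a : ℝ} (h0 : 0 < θ) (h1 : θ ≤ Real.pi / 2) (hq0 : 0 ≤ q)
    (hq : q ^ 2 = Real.cos θ) (ha : 0 < a) :
    Real.sin θ * ((√(1 - q))⁻¹ ^ q * a) ^ (2 / (1 + q)) ≤ 2 * a ^ (2 / (1 + q)) := by
  have hcos : Real.cos θ < 1 := by
    rw [← Real.cos_zero]
    exact Real.cos_lt_cos_of_nonneg_of_le_pi_div_two le_rfl h1 h0
  have hq1 : q < 1 := by nlinarith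
  have hs : 0 < √(1 - q) := Real.sqrt_pos.2 (by linarith)
  have hB1 : 1 ≤ (√(1 - q))⁻¹ := by
    rw [one_le_inv₀ hs]
    exact Real.sqrt_le_iff.2 ⟨zero_le_one, by linarith⟩
  have hsin0 : 0 ≤ Real.sin θ :=
    Real.sin_nonneg_of_nonneg_of_le_pi h0.le (by linarith [Real.pi_pos])
  rw [Real.mul_rpow (by positivity) ha.le, ← mul_assoc]
  refine mul_le_mul_of_nonneg_right ?_ (by positivity)
  rw [← Real.rpow_mul (by positivity)]
  have hexp : q * (2 / (1 + q)) ≤ 1 := by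
    rw [← mul_div_assoc, div_le_one (by linarith)]
    linarith
  calc Real.sin θ * (√(1 - q))⁻¹ ^ (q * (2 / (1 + q)))
      ≤ Real.sin θ * (√(1 - q))⁻¹ := by
        refine mul_le_mul_of_nonneg_left ?_ hsin0
        simpa using Real.rpow_le_rpow_of_exponent_le hB1 hexp
    _ ≤ 2 := by
        rw [← div_eq_mul_inv, div_le_iff₀ hs]
        have h4 : Real.sin θ ^ 2 ≤ (2 * √(1 - q)) ^ 2 := by
          rw [mul_pow, Real.sq_sqrt (by linarith), Real.sin_sq, ← hq]
          -- `1 - q⁴ = (1 - q)(1 + q)(1 + q²)`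
          have : (1 + q) * (1 + q ^ 2) ≤ 4 := by nlinarith
          nlinarith [mul_le_mul_of_nonneg_left this (by linarith : 0 ≤ 1 - q)]
        exact (pow_le_pow_iff_left₀ hsin0 (by positivity) two_ne_zero).1 h4

/-- The gain from hypercontractivity. For `a ≤ 1` it comes from the part of the exponent in excess
of `1`, which is at least `θ² / (2π²)`; for `a ≥ 1` the exponent is only bounded by `2`. -/
lemma rpow_two_div_le {θ q a : ℝ} (h0 : 0 ≤ θ) (h1 : θ ≤ Real.pi / 2) (hq0 : 0 ≤ q)
    (hq : q ^ 2 = Real.cos θ) (ha : 0 < a) :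
    a ^ (2 / (1 + q)) ≤ Real.exp 1 * (a * (1 + a)) *
      Real.exp (-((1 + Real.posLog (1 / a)) / (2 * Real.pi ^ 2)) * θ ^ 2) := by
  have hpi := Real.pi_pos
  have hq1 : q ≤ 1 := by nlinarith [Real.cos_le_one θ]
  have hκ : θ ^ 2 / (2 * Real.pi ^ 2) ≤ 1 := by
    rw [div_le_one (by positivity)]
    nlinarith
  have hcos : 1 - q ≥ θ ^ 2 / Real.pi ^ 2 := by
    have := Real.cos_le_one_sub_mul_cos_sq (x := θ) (by rw [abs_of_nonneg h0]; linarith)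
    rw [← hq] at this
    have e : 2 / Real.pi ^ 2 * θ ^ 2 = 2 * (θ ^ 2 / Real.pi ^ 2) := by ring
    nlinarith
  have e : -((1 + Real.posLog (1 / a)) / (2 * Real.pi ^ 2)) * θ ^ 2 =
      -(θ ^ 2 / (2 * Real.pi ^ 2)) + -(Real.posLog (1 / a) * (θ ^ 2 / (2 * Real.pi ^ 2))) := by
    ring
  -- The factor `exp 1` pays for the summand `1` in `1 + log⁺ (1 / a)`.
  rw [e, Real.exp_add]
  have hexp1 : 1 ≤ Real.exp 1 * Real.exp (-(θ ^ 2 / (2 * Real.pi ^ 2))) := by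
    rw [← Real.exp_add, Real.one_le_exp_iff]
    linarith
  suffices h : a ^ (2 / (1 + q)) ≤ a * (1 + a) *
      Real.exp (-(Real.posLog (1 / a) * (θ ^ 2 / (2 * Real.pi ^ 2)))) by
    refine h.trans ?_
    have := mul_le_mul_of_nonneg_left hexp1 (by positivity : 0 ≤ a * (1 + a) *
      Real.exp (-(Real.posLog (1 / a) * (θ ^ 2 / (2 * Real.pi ^ 2)))))
    linarith
  rcases le_total 1 a with h | h
  · have hL : Real.posLog (1 / a) = 0 := by
      rw [Real.posLog_eq_zero_iff, abs_of_nonneg (by positivity), div_le_one ha]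
      exact h
    rw [hL, zero_mul, neg_zero, Real.exp_zero, mul_one]
    calc a ^ (2 / (1 + q)) ≤ a ^ (2 : ℝ) :=
          Real.rpow_le_rpow_of_exponent_le h (div_le_self zero_le_two (by linarith))
      _ ≤ a * (1 + a) := by rw [Real.rpow_two]; nlinarith
  · have hL : Real.posLog (1 / a) = -Real.log a := by
      rw [Real.posLog_eq_log, Real.log_div one_ne_zero ha.ne', Real.log_one, zero_sub]
      rw [abs_of_nonneg (by positivity), le_div_iff₀ ha]
      linarith
    have hlog : Real.log a ≤ 0 := Real.log_nonpos ha.le h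
    rw [hL]
    have hsplit : (2 : ℝ) / (1 + q) = 1 + (1 - q) / (1 + q) := by
      field_simp
      ring
    have hτ : θ ^ 2 / (2 * Real.pi ^ 2) ≤ (1 - q) / (1 + q) := by
      calc θ ^ 2 / (2 * Real.pi ^ 2) = θ ^ 2 / Real.pi ^ 2 / 2 := by field_simp
        _ ≤ (1 - q) / 2 := by gcongr
        _ ≤ (1 - q) / (1 + q) := by
          apply div_le_div_of_nonneg_left <;> linarith
    calc a ^ (2 / (1 + q)) = a * Real.exp (Real.log a * ((1 - q) / (1 + q))) := by
          rw [hsplit, Real.rpow_add ha, Real.rpow_one, Real.rpow_def_of_pos ha]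
      _ ≤ a * Real.exp (Real.log a * (θ ^ 2 / (2 * Real.pi ^ 2))) := by
          exact mul_le_mul_of_nonneg_left
            (Real.exp_le_exp.2 (mul_le_mul_of_nonpos_left hτ hlog)) ha.le
      _ ≤ _ := by
          rw [neg_mul, neg_neg]
          refine mul_le_mul_of_nonneg_right ?_ (Real.exp_pos _).le
          nlinarith

lemma intervalIntegral_exp_neg_mul_sq_le {b : ℝ} (hb : 0 < b) {T : ℝ} (hT : 0 ≤ T) :
    ∫ θ in (0 : ℝ)..T, Real.exp (-b * θ ^ 2) ≤ √(Real.pi / b) / 2 := by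
  rw [intervalIntegral.integral_of_le hT, ← integral_gaussian_Ioi]
  exact setIntegral_mono_set (integrable_exp_neg_mul_sq hb).integrableOn
    (Eventually.of_forall fun _ => (Real.exp_pos _).le)
    (LE.le.eventuallyLE Set.Ioc_subset_Ioi_self)

/-- The function `a ↦ a (1 + a) / [1 + log⁺ (1 / a)] ^ (1 / 2)` on the reals; its value at `0` is
the limit value `0`. -/
noncomputable def influenceReal (a : ℝ) : ℝ := a * (1 + a) / √(1 + Real.posLog (1 / a))

lemma influenceFun_ofReal {a : ℝ} (ha : 0 ≤ a) :
    influenceFun (ENNReal.ofReal a) = ENNReal.ofReal (influenceReal a) := by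
  rcases ha.eq_or_lt with rfl | ha
  · simp [influenceFun, influenceReal]
  have hL := Real.posLog_nonneg (x := 1 / a)
  rw [influenceFun, influenceReal, ENNReal.ofReal_div_of_pos (Real.sqrt_pos.2 (by linarith)),
    ENNReal.ofReal_mul ha.le, ENNReal.ofReal_add zero_le_one ha.le, ENNReal.ofReal_one,
    ENNReal.toReal_div, ENNReal.toReal_ofReal ha.le, ENNReal.toReal_one]

lemma tendsto_influenceReal {a : ℝ} (ha : 0 ≤ a) {δ : ℕ → ℝ} (hδ : ∀ k, 0 < δ k)
    (hlim : Tendsto δ atTop (𝓝 0)) :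
    Tendsto (fun k => influenceReal (a + δ k)) atTop (𝓝 (influenceReal a)) := by
  have hadd : Tendsto (fun k => a + δ k) atTop (𝓝 a) := by simpa using hlim.const_add a
  rcases ha.eq_or_lt with rfl | ha
  · simp only [zero_add]
    have h0 : influenceReal 0 = 0 := by simp [influenceReal]
    rw [h0]
    have hup : Tendsto (fun k => δ k * (1 + δ k)) atTop (𝓝 0) := by
      simpa using hlim.mul (hlim.const_add 1)
    refine squeeze_zero (fun k => ?_) (fun k => ?_) hup
    · have := hδ k
      rw [influenceReal]
      positivity
    · have := hδ k
      refine div_le_self (by positivity) ?_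
      rw [Real.one_le_sqrt]
      linarith [Real.posLog_nonneg (x := 1 / δ k)]
  · have hc : ContinuousAt influenceReal a := by
      have hL : ContinuousAt (fun a : ℝ => Real.posLog (1 / a)) a := by
        exact Real.continuous_posLog.continuousAt.comp
          (continuousAt_const.div continuousAt_id ha.ne')
      refine ContinuousAt.div (by fun_prop) (hL.const_add 1).sqrt ?_
      have := Real.posLog_nonneg (x := 1 / a)
      positivity
    exact hc.tendsto.comp hadd

/-- Comparison with a Gaussian integral of variance of order `1 / (1 + log⁺ (1 / a))`. -/
lemma intervalIntegral_influence_le {a : ℝ} (ha : 0 < a) :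
    ∫ θ in (0 : ℝ)..(Real.pi / 2), 2 * (Real.exp 1 * (a * (1 + a)) *
      Real.exp (-((1 + Real.posLog (1 / a)) / (2 * Real.pi ^ 2)) * θ ^ 2)) ≤
        32 * influenceReal a := by
  have hL := Real.posLog_nonneg (x := 1 / a)
  have hpi := Real.pi_pos
  set L := Real.posLog (1 / a)
  have hb : 0 < (1 + L) / (2 * Real.pi ^ 2) := by positivity
  have h := intervalIntegral_exp_neg_mul_sq_le hb (T := Real.pi / 2) (by positivity)
  simp only [intervalIntegral.integral_const_mul]
  have e : Real.pi / ((1 + L) / (2 * Real.pi ^ 2)) = 2 * Real.pi ^ 3 / (1 + L) := by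
    field_simp
  rw [e, Real.sqrt_div (by positivity)] at h
  have h8 : √(2 * Real.pi ^ 3) ≤ 8 := by
    rw [Real.sqrt_le_left (by norm_num)]
    have : Real.pi ^ 3 ≤ 3.15 ^ 3 := pow_le_pow_left₀ hpi.le Real.pi_lt_d2.le 3
    norm_num at this ⊢
    linarith
  have he : Real.exp 1 ≤ 4 := by linarith [Real.exp_one_lt_d9]
  have hs : 0 < √(1 + L) := Real.sqrt_pos.2 (by linarith)
  calc 2 * (Real.exp 1 * (a * (1 + a)) *
        ∫ θ in (0 : ℝ)..(Real.pi / 2), Real.exp (-((1 + L) / (2 * Real.pi ^ 2)) * θ ^ 2))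
      ≤ 2 * (4 * (a * (1 + a)) * (8 / √(1 + L) / 2)) := by
        refine mul_le_mul_of_nonneg_left (mul_le_mul ?_ (h.trans ?_) ?_ ?_) zero_le_two
        · gcongr
        · gcongr
        · exact intervalIntegral.integral_nonneg (by positivity) fun _ _ => (Real.exp_pos _).le
        · positivity
    _ = 32 * influenceReal a := by
        rw [influenceReal]
        ring

variable {E : Type*} [NormedAddCommGroup E] [InnerProductSpace ℝ E] [FiniteDimensional ℝ E]
  [MeasurableSpace E] [BorelSpace E]

/-- The pointwise bound in `θ` for the contribution of one subspace to the variance. -/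
lemma sin_mul_correlation_le {f : E → ℝ} (hf : ContDiff ℝ 1 f) (h1 : ∀ x, |f x| ≤ 1) {K' : ℝ}
    (hK' : ∀ x, ‖fderiv ℝ f x‖ ≤ K') (Q : Submodule ℝ E) {a : ℝ} (ha0 : 0 < a)
    (ha : ∫ x, ‖Q.starProjection (gradient f x)‖ ∂(stdGaussian E) ≤ a) {θ : ℝ} (hθ0 : 0 ≤ θ)
    (hθ1 : θ ≤ Real.pi / 2) :
    Real.sin θ * ∫ v, ⟪Q.starProjection (gradient f v.fst), Q.starProjection (gradient f v.snd)⟫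
        ∂(gaussianCoupling E (Real.cos θ)) ≤
      2 * (Real.exp 1 * (a * (1 + a)) *
        Real.exp (-((1 + Real.posLog (1 / a)) / (2 * Real.pi ^ 2)) * θ ^ 2)) := by
  rcases hθ0.eq_or_lt with rfl | hθ
  · rw [Real.sin_zero, zero_mul]
    positivity
  have hcos0 : 0 ≤ Real.cos θ := Real.cos_nonneg_of_mem_Icc ⟨by linarith [Real.pi_pos], hθ1⟩
  have hcos1 : Real.cos θ < 1 := by
    rw [← Real.cos_zero]
    exact Real.cos_lt_cos_of_nonneg_of_le_pi_div_two le_rfl hθ1 hθ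
  have hsin0 : 0 ≤ Real.sin θ :=
    Real.sin_nonneg_of_nonneg_of_le_pi hθ.le (by linarith [Real.pi_pos])
  -- With `s = ρ^{1/4}` the correlation `ρ = s * s² * s` is shared between smoothing `g` on both
  -- sides and hypercontractivity.
  set s := √(√(Real.cos θ)) with hs
  have hs2 : s ^ 2 = √(Real.cos θ) := Real.sq_sqrt (Real.sqrt_nonneg _)
  have hs4 : s ^ 4 = Real.cos θ := by
    rw [show s ^ 4 = (s ^ 2) ^ 2 by ring, hs2, Real.sq_sqrt hcos0]
  have hslt : s ^ 2 < 1 := by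
    rw [hs2, Real.sqrt_lt' one_pos, one_pow]
    exact hcos1
  have hgc := hf.continuous_gradient
  have hgb : ∀ x, ‖Q.starProjection (gradient f x)‖ ≤ K' := fun x =>
    (Q.norm_starProjection_apply_le _).trans
      (by rw [norm_gradient_eq_norm_fderiv]; exact hK' x)
  have key := integral_inner_gaussianCoupling_le_of_bound hslt.le
    (g := fun x => Q.starProjection (gradient f x)) (by fun_prop) hgb
    (norm_ornsteinUhlenbeck_starProjection_gradient_le Q hf h1 hK' hslt) ha
  rw [hs4] at key
  have hq : (s ^ 2) ^ 2 = Real.cos θ := by rw [← hs4]; ring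
  refine (mul_le_mul_of_nonneg_left key hsin0).trans ?_
  refine (sin_mul_rpow_le_mul_rpow hθ hθ1 (sq_nonneg s) hq ha0).trans ?_
  exact mul_le_mul_of_nonneg_left (rpow_two_div_le hθ0 hθ1 (sq_nonneg s) hq ha0) zero_le_two

end Estimate

/-! ### Decompositions of the identity and truncation -/

section Main

open Filter Topology WithLp
open scoped RealInnerProductSpace

section Decomposition

variable {n m : ℕ} {E : Fin m → Submodule ℝ (EuclideanSpace ℝ (Fin n))} {c : Fin m → ℝ}

lemma IsGeometricBrascampLieb.inner_eq_sum (h : IsGeometricBrascampLieb E c)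
    (x y : EuclideanSpace ℝ (Fin n)) :
    ⟪x, y⟫ = ∑ i, c i * ⟪(E i).starProjection x, (E i).starProjection y⟫ := by
  have hx : x = ∑ i, c i • (E i).starProjection x := by
    simpa using congrArg (fun T => T x) h.2
  conv_lhs => rw [hx, sum_inner]
  refine Finset.sum_congr rfl fun i _ => ?_
  rw [real_inner_smul_left, ← Submodule.inner_starProjection_left_eq_right,
    Submodule.starProjection_eq_self_iff.2 (Submodule.starProjection_apply_mem _ x)]

/-- The inequality for functions with bounded derivative. The numbers `a i` are upper bounds of
the `L¹` norms rather than the norms themselves, so that they can be taken positive. -/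
lemma variance_le_sum_influenceReal (h : IsGeometricBrascampLieb E c)
    {f : EuclideanSpace ℝ (Fin n) → ℝ} (hf : ContDiff ℝ 1 f) (h1 : ∀ x, |f x| ≤ 1) {K' : ℝ}
    (hK' : ∀ x, ‖fderiv ℝ f x‖ ≤ K') {a : Fin m → ℝ} (ha0 : ∀ i, 0 < a i)
    (ha : ∀ i, ∫ x, ‖(E i).starProjection (gradient f x)‖
      ∂(stdGaussian (EuclideanSpace ℝ (Fin n))) ≤ a i) :
    variance f (stdGaussian (EuclideanSpace ℝ (Fin n))) ≤
      32 * ∑ i, c i * influenceReal (a i) := by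
  have hgc := hf.continuous_gradient
  let b : Fin m → ℝ → ℝ := fun i θ => 2 * (Real.exp 1 * (a i * (1 + a i)) *
    Real.exp (-((1 + Real.posLog (1 / a i)) / (2 * Real.pi ^ 2)) * θ ^ 2))
  have hb : ∀ i, Continuous (b i) := fun i => by fun_prop
  rw [variance_eq_integral_correlation hf h1 hK']
  calc _ ≤ ∫ θ in (0 : ℝ)..(Real.pi / 2), ∑ i, c i * b i θ := by
        refine intervalIntegral.integral_mono_on (by positivity)
          (intervalIntegrable_sin_mul_correlation hf h1 hK')
          (Continuous.intervalIntegrable (by fun_prop) _ _) fun θ hθ => ?_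
        have hint : ∀ i, Integrable (fun v : WithLp 2 (EuclideanSpace ℝ (Fin n) ×
            EuclideanSpace ℝ (Fin n)) => c i * ⟪(E i).starProjection (gradient f v.fst),
              (E i).starProjection (gradient f v.snd)⟫)
            (gaussianCoupling (EuclideanSpace ℝ (Fin n)) (Real.cos θ)) := by
          intro i
          refine Integrable.const_mul ?_ _
          have hgb : ∀ x, ‖(E i).starProjection (gradient f x)‖ ≤ K' := fun x =>
            ((E i).norm_starProjection_apply_le _).trans
              (by rw [norm_gradient_eq_norm_fderiv]; exact hK' x)
          refine integrable_of_continuous_bounded (by fun_prop) (K := K' * K') fun v => ?_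
          exact (norm_inner_le_norm _ _).trans
            (mul_le_mul (hgb _) (hgb _) (norm_nonneg _) ((norm_nonneg _).trans (hgb 0)))
        have hsum : ∀ v : WithLp 2 (EuclideanSpace ℝ (Fin n) × EuclideanSpace ℝ (Fin n)),
            ⟪gradient f v.fst, gradient f v.snd⟫ = _ := fun v => h.inner_eq_sum _ _
        simp only [hsum]
        rw [integral_finsetSum _ fun i _ => hint i, Finset.mul_sum]
        refine Finset.sum_le_sum fun i _ => ?_
        rw [integral_const_mul, mul_left_comm]
        exact mul_le_mul_of_nonneg_left
          (sin_mul_correlation_le hf h1 hK' (E i) (ha0 i) (ha i) hθ.1 hθ.2) (h.1 i).le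
    _ = ∑ i, c i * ∫ θ in (0 : ℝ)..(Real.pi / 2), b i θ := by
        rw [intervalIntegral.integral_finsetSum fun i _ =>
          ((hb i).const_mul (c i)).intervalIntegrable _ _]
        simp only [intervalIntegral.integral_const_mul]
    _ ≤ ∑ i, c i * (32 * influenceReal (a i)) :=
        Finset.sum_le_sum fun i _ =>
          mul_le_mul_of_nonneg_left (intervalIntegral_influence_le (ha0 i)) (h.1 i).le
    _ = 32 * ∑ i, c i * influenceReal (a i) := by
        rw [Finset.mul_sum]
        exact Finset.sum_congr rfl fun i _ => by ring

end Decomposition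

section Truncation

variable {E : Type*} [NormedAddCommGroup E] [InnerProductSpace ℝ E] [FiniteDimensional ℝ E]

/-- Smooth cutoffs with values in `[0, 1]`, equal to `1` eventually at every point, whose
gradients tend uniformly to `0`. -/
lemma exists_smooth_cutoff :
    ∃ (χ : ℕ → E → ℝ) (M : ℝ), (∀ k, ContDiff ℝ ∞ (χ k)) ∧ (∀ k, HasCompactSupport (χ k)) ∧
      (∀ k x, 0 ≤ χ k x ∧ χ k x ≤ 1) ∧ (∀ x, ∀ᶠ k in atTop, χ k x = 1) ∧
      ∀ k x, ‖fderiv ℝ (χ k) x‖ ≤ M / (k + 1) := by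
  let φ : ContDiffBump (0 : E) := ⟨1, 2, one_pos, one_lt_two⟩
  obtain ⟨M, hM⟩ := (φ.hasCompactSupport.fderiv (𝕜 := ℝ)).exists_bound_of_continuous
    (φ.contDiff.continuous_fderiv (n := ∞) (by simp))
  have hpos : ∀ k : ℕ, (0 : ℝ) < ((k : ℝ) + 1)⁻¹ := fun k => by positivity
  refine ⟨fun k x => φ (((k : ℝ) + 1)⁻¹ • x), M, fun k => ?_, fun k => ?_,
    fun k x => ⟨φ.nonneg, φ.le_one⟩, fun x => ?_, fun k x => ?_⟩
  · exact φ.contDiff.comp (contDiff_const_smul _)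
  · exact φ.hasCompactSupport.comp_smul (hpos k).ne'
  · filter_upwards [eventually_ge_atTop ⌈‖x‖⌉₊] with k hk
    refine φ.one_of_mem_closedBall ?_
    have : ‖x‖ ≤ k := (Nat.le_ceil _).trans (by exact_mod_cast hk)
    rw [mem_closedBall_zero_iff, norm_smul, Real.norm_of_nonneg (hpos k).le]
    change _ ≤ (1 : ℝ)
    rw [inv_mul_le_iff₀ (by positivity)]
    linarith
  · have hd : HasFDerivAt (fun x => φ (((k : ℝ) + 1)⁻¹ • x)) _ x :=
      ((φ.contDiff (n := 1)).differentiable one_ne_zero _).hasFDerivAt.comp x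
        ((hasFDerivAt_id x).const_smul ((k : ℝ) + 1)⁻¹)
    rw [hd.fderiv, ContinuousLinearMap.comp_smul, norm_smul, Real.norm_of_nonneg (hpos k).le,
      div_eq_inv_mul]
    refine mul_le_mul_of_nonneg_left ?_ (hpos k).le
    exact hM _

lemma gradient_mul {f g : E → ℝ} {x : E} (hf : DifferentiableAt ℝ f x)
    (hg : DifferentiableAt ℝ g x) :
    gradient (fun x => f x * g x) x = f x • gradient g x + g x • gradient f x := by
  refine ext_inner_right ℝ fun w => ?_
  simp only [inner_gradient_eq_fderiv, inner_add_left, real_inner_smul_left]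
  rw [fderiv_fun_mul hf hg]
  simp

lemma tendsto_variance_of_bounded {α : Type*} [TopologicalSpace α] [MeasurableSpace α]
    [OpensMeasurableSpace α] {μ : Measure α} [IsProbabilityMeasure μ] {F : ℕ → α → ℝ}
    {f : α → ℝ} (hF : ∀ k, Continuous (F k)) (hf : Continuous f) (hF1 : ∀ k x, |F k x| ≤ 1)
    (hf1 : ∀ x, |f x| ≤ 1) (hlim : ∀ x, Tendsto (fun k => F k x) atTop (𝓝 (f x))) :
    Tendsto (fun k => variance (F k) μ) atTop (𝓝 (variance f μ)) := by
  have hmem : ∀ {g : α → ℝ}, Continuous g → (∀ x, |g x| ≤ 1) → MemLp g 2 μ := fun hg hg1 =>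
    MemLp.of_bound hg.aestronglyMeasurable 1 (Eventually.of_forall hg1)
  rw [variance_eq_sub (hmem hf hf1)]
  simp only [fun k => variance_eq_sub (hmem (hF k) (hF1 k))]
  refine Tendsto.sub ?_ (Tendsto.pow ?_ 2)
  · refine tendsto_integral_of_dominated_convergence (fun _ => 1)
      (fun k => ((hF k).pow 2).aestronglyMeasurable) (integrable_const _)
      (fun k => Eventually.of_forall fun x => ?_) (Eventually.of_forall fun x => (hlim x).pow 2)
    rw [Pi.pow_apply, norm_pow]
    exact pow_le_one₀ (norm_nonneg _) (hF1 k x)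
  · exact tendsto_integral_of_dominated_convergence (fun _ => 1)
      (fun k => (hF k).aestronglyMeasurable) (integrable_const _)
      (fun k => Eventually.of_forall fun x => hF1 k x) (Eventually.of_forall hlim)

end Truncation

/-- The inequality with real-valued right-hand side, when all projected gradients are
integrable. -/
lemma variance_le_sum_influenceReal_of_integrable {n m : ℕ}
    {E : Fin m → Submodule ℝ (EuclideanSpace ℝ (Fin n))} {c : Fin m → ℝ}
    (h : IsGeometricBrascampLieb E c)
    {f : EuclideanSpace ℝ (Fin n) → ℝ} (hf : ContDiff ℝ ∞ f) (h1 : ∀ x, |f x| ≤ 1)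
    (hint : ∀ i, Integrable (fun x => (E i).starProjection (gradient f x))
      (stdGaussian (EuclideanSpace ℝ (Fin n)))) :
    variance f (stdGaussian (EuclideanSpace ℝ (Fin n))) ≤
      32 * ∑ i, c i * influenceReal (∫ x, ‖(E i).starProjection (gradient f x)‖
        ∂(stdGaussian (EuclideanSpace ℝ (Fin n)))) := by
  obtain ⟨χ, M, hχ, hχc, hχ01, hχ1, hχM⟩ := exists_smooth_cutoff (E := EuclideanSpace ℝ (Fin n))
  have hM0 : 0 ≤ M := by simpa using (norm_nonneg _).trans (hχM 0 0)
  have hFs : ∀ k, ContDiff ℝ 1 fun x => f x * χ k x := fun k =>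
    (hf.mul (hχ k)).of_le (by exact_mod_cast le_top)
  have hF1 : ∀ k x, |f x * χ k x| ≤ 1 := fun k x => by
    rw [abs_mul, abs_of_nonneg (hχ01 k x).1]
    exact mul_le_one₀ (h1 x) (hχ01 k x).1 (hχ01 k x).2
  have hvar := tendsto_variance_of_bounded
    (μ := stdGaussian (EuclideanSpace ℝ (Fin n))) (fun k => (hFs k).continuous) hf.continuous
    hF1 h1 fun x => tendsto_const_nhds.congr' <| by
      filter_upwards [hχ1 x] with k hk
      rw [hk, mul_one]
  -- `M + 1` instead of `M` keeps `δ k`, and with it the bounds on the `L¹` norms, positive.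
  let δ : ℕ → ℝ := fun k => (M + 1) / (k + 1)
  have hδ : ∀ k, 0 < δ k := fun k => by positivity
  have hδlim : Tendsto δ atTop (𝓝 0) :=
    tendsto_const_nhds.div_atTop (tendsto_natCast_atTop_atTop.atTop_add tendsto_const_nhds)
  refine le_of_tendsto_of_tendsto' hvar ((tendsto_finsetSum _ fun i _ =>
    ((tendsto_influenceReal (integral_nonneg fun x => norm_nonneg _) hδ hδlim).const_mul
      (c i))).const_mul 32) fun k => ?_
  obtain ⟨K', hK'⟩ := (((hχc k).mul_left (f := f)).fderiv (𝕜 := ℝ)).exists_bound_of_continuous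
    ((hFs k).continuous_fderiv one_ne_zero)
  refine variance_le_sum_influenceReal h (hFs k) (hF1 k) hK'
    (fun i => add_pos_of_nonneg_of_pos (integral_nonneg fun x => norm_nonneg _) (hδ k))
    fun i => ?_
  have hpt : ∀ x, ‖(E i).starProjection (gradient (fun x => f x * χ k x) x)‖ ≤
      ‖(E i).starProjection (gradient f x)‖ + δ k := by
    intro x
    rw [gradient_mul (hf.differentiable (by simp) x) ((hχ k).differentiable (by simp) x),
      map_add, map_smul, map_smul, add_comm]
    refine (norm_add_le _ _).trans (add_le_add ?_ ?_)
    · rw [norm_smul, Real.norm_of_nonneg (hχ01 k x).1]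
      exact mul_le_of_le_one_left (norm_nonneg _) (hχ01 k x).2
    · rw [norm_smul]
      refine (mul_le_of_le_one_left (norm_nonneg _) (h1 x)).trans ?_
      refine ((E i).norm_starProjection_apply_le _).trans ?_
      rw [norm_gradient_eq_norm_fderiv]
      refine (hχM k x).trans ?_
      simp only [δ]
      gcongr
      linarith
  calc _ ≤ ∫ x, (‖(E i).starProjection (gradient f x)‖ + δ k)
        ∂(stdGaussian (EuclideanSpace ℝ (Fin n))) :=
        integral_mono_of_nonneg (Eventually.of_forall fun x => norm_nonneg _)
          ((hint i).norm.add (integrable_const _)) (Eventually.of_forall hpt)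
    _ = _ := by
        rw [integral_add (hint i).norm (integrable_const _)]
        simp

end Main

theorem proposition9 :
    ∃ C : ℝ≥0, 0 < C ∧
      ∀ (n m : ℕ) (E : Fin m → Submodule ℝ (EuclideanSpace ℝ (Fin n))) (c : Fin m → ℝ),
        IsGeometricBrascampLieb E c →
        ∀ f : EuclideanSpace ℝ (Fin n) → ℝ, ContDiff ℝ ∞ f → (∀ x, |f x| ≤ 1) →
          ENNReal.ofReal (variance f (stdGaussian (EuclideanSpace ℝ (Fin n)))) ≤
            (C : ℝ≥0∞) * ∑ i, ENNReal.ofReal (c i) * influenceFun (projGradL1 (E i) f) := by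
  refine ⟨32, by norm_num, fun n m E c h f hf h1 => ?_⟩
  have hgc : Continuous (gradient f) :=
    (hf.of_le (by exact_mod_cast le_top) : ContDiff ℝ 1 f).continuous_gradient
  by_cases hfin : ∀ i, projGradL1 (E i) f ≠ ⊤
  · have hint : ∀ i, Integrable (fun x => (E i).starProjection (gradient f x))
        (stdGaussian (EuclideanSpace ℝ (Fin n))) := fun i =>
      memLp_one_iff_integrable.1 ⟨Continuous.aestronglyMeasurable (by fun_prop),
        (hfin i).lt_top⟩
    have hL1 : ∀ i, projGradL1 (E i) f = ENNReal.ofReal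
        (∫ x, ‖(E i).starProjection (gradient f x)‖
          ∂(stdGaussian (EuclideanSpace ℝ (Fin n)))) := fun i => by
      rw [projGradL1, eLpNorm_one_eq_lintegral_enorm,
        ofReal_integral_norm_eq_lintegral_enorm (hint i)]
    have hnn : ∀ i, 0 ≤ ∫ x, ‖(E i).starProjection (gradient f x)‖
        ∂(stdGaussian (EuclideanSpace ℝ (Fin n))) := fun i =>
      integral_nonneg fun x => norm_nonneg _
    simp only [hL1, influenceFun_ofReal (hnn _)]
    refine (ENNReal.ofReal_le_ofReal
      (variance_le_sum_influenceReal_of_integrable h hf h1 hint)).trans (le_of_eq ?_)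
    have hinf : ∀ a : ℝ, 0 ≤ a → 0 ≤ influenceReal a := fun a ha => by
      rw [influenceReal]
      positivity
    rw [ENNReal.ofReal_mul (by norm_num), ENNReal.ofReal_sum_of_nonneg fun i _ =>
      mul_nonneg (h.1 i).le (hinf _ (hnn i))]
    simp only [ENNReal.ofReal_mul (h.1 _).le]
    simp
  · push Not at hfin
    obtain ⟨i, hi⟩ := hfin
    have htop : ∑ i, ENNReal.ofReal (c i) * influenceFun (projGradL1 (E i) f) = ⊤ := by
      refine ENNReal.sum_eq_top.2 ⟨i, Finset.mem_univ i, ?_⟩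
      rw [hi, influenceFun]
      simp [ENNReal.mul_top, h.1 i]
    rw [htop, ENNReal.mul_top (by norm_num)]
    exact le_top
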